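/- For a Borel probability measure $\mu$ on $\mathbb{R}^d$ write $M_q(\mu)=\int\|x\|^q\,d\mu(x)$ ($\|\cdot\|$ Euclidean), and let $$\mathcal W_p(\mu,\nu)=\Big(\inf_{\pi}\int\|x-y\|^p\,d\pi(x,y)\Big)^{1/p},$$ the infimum over all $\pi$ with marginals $\mu,\nu$. For integers $1\le k\le d$ let $\mathbb S_{d,k}=\{E\in\mathbb R^{d\times k}:E^\top E=I_k\}$, let $\sigma$ be the uniform (orthogonally invariant) probability measure on $\mathbb S_{d,k}$, and let $E^\star_\#\mu$ be the push-forward of $\mu$ under $x\mapsto E^\top x$. The integral projection robust Wasserstein distance is $$\underline{\mathcal{PW}}_{p,k}(\mu,\nu)=\Big(\int_{\mathbb S_{d,k}}\mathcal W_p^p(E^\star_\#\mu,E^\star_\#\nu)\,d\sigma(E)\Big)^{1/p}.$$ **Theorem.** Let $q\ge p\ge 1$ be real numbers. There is a constant $C_{p,q}>0$, depending only on $(p,q)$, such that for all integers $1\le k\le d$, every Borel probability measure $\mu_\star$ on $\mathbb R^d$ with $M_q(\mu_\star)<\infty$, and every integer $n\ge 2$ (and also for $n=1$ if $\zeta_{p,q,k}=0$),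 the empirical measure $\widehat\mu_n=\frac1n\sum_{i=1}^n\delta_{X_i}$ of i.i.d. samples $X_1,\dots,X_n\sim\mu_\star$ satisfies $$\mathbb E\big[\underline{\mathcal{PW}}_{p,k}(\widehat\mu_n,\mu_\star)\big]\;\le\; C_{p,q}\,M_q(\mu_\star)^{1/q}\;n^{-\left[\frac1{(2p)\vee k}\wedge\left(\frac1p-\frac1q\right)\right]}(\log n)^{\zeta_{p,q,k}/p},$$ where $$\zeta_{p,q,k}=\begin{cases}2&\text{if }k=q=2p,\\ 1&\text{if }\big(k\ne 2p,\ k\neq p\text{ and }q=\tfrac{kp}{k-p}\big)\text{ or }(k<2p\text{ and }q=2p)\text{ or }(q>k=2p),\\ 0&\text{otherwise.}\end{cases}$$ In particular the bound does not depend on the ambient dimension $d$. -/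

import Mathlib

open MeasureTheory ProbabilityTheory
open scoped ENNReal Matrix

noncomputable section

/-- `𝕊_{d,k}`: the real `d × k` matrices with orthonormal columns, `Eᵀ E = I_k`. -/
def Stiefel (d k : ℕ) : Type := {E : Matrix (Fin d) (Fin k) ℝ // Eᵀ * E = 1}

namespace Stiefel

instance (d k : ℕ) : TopologicalSpace (Stiefel d k) :=
  inferInstanceAs (TopologicalSpace {E : Matrix (Fin d) (Fin k) ℝ // Eᵀ * E = 1})

instance (d k : ℕ) : MeasurableSpace (Stiefel d k) := borel _

instance (d k : ℕ) : BorelSpace (Stiefel d k) := ⟨rfl⟩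

/-- The map `E^⋆ : ℝ^d → ℝ^k`, `x ↦ Eᵀ x`. -/
def proj {d k : ℕ} (E : Stiefel d k) (x : EuclideanSpace ℝ (Fin d)) : EuclideanSpace ℝ (Fin k) :=
  WithLp.toLp 2 (E.1ᵀ *ᵥ x.ofLp)

/-- The matrix `Q E`, for `Q` orthogonal and `E` with orthonormal columns. -/
def rotate {d k : ℕ} (Q : Matrix.orthogonalGroup (Fin d) ℝ) (E : Stiefel d k) : Stiefel d k :=
  ⟨Q.1 * E.1, by
    have hQ : Q.1ᵀ * Q.1 = 1 := (Matrix.mem_orthogonalGroup_iff' _ _).1 Q.2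
    rw [Matrix.transpose_mul, Matrix.mul_assoc, ← Matrix.mul_assoc Q.1ᵀ, hQ, Matrix.one_mul, E.2]⟩

/-- The first `k` columns of the identity matrix of size `d`. -/
def base {d k : ℕ} (h : k ≤ d) : Stiefel d k :=
  ⟨(1 : Matrix (Fin d) (Fin d) ℝ).submatrix id (Fin.castLE h), by
    rw [Matrix.transpose_submatrix, Matrix.transpose_one,
      ← Matrix.submatrix_mul _ _ _ _ _ Function.bijective_id]
    ext i j
    simp [Matrix.one_apply, Fin.ext_iff]⟩

end Stiefel

instance (d : ℕ) : MeasurableSpace (Matrix.orthogonalGroup (Fin d) ℝ) := borel _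

instance (d : ℕ) : BorelSpace (Matrix.orthogonalGroup (Fin d) ℝ) := ⟨rfl⟩

instance (d : ℕ) : CompactSpace (Matrix.orthogonalGroup (Fin d) ℝ) := by
  have hcomp : IsCompact (Set.univ.pi fun _ : Fin d => Set.univ.pi fun _ : Fin d =>
      Set.Icc (-1 : ℝ) 1) :=
    isCompact_univ_pi fun _ => isCompact_univ_pi fun _ => isCompact_Icc
  refine isCompact_iff_compactSpace.1 (hcomp.of_isClosed_subset ?_ ?_)
  · exact isClosed_unitary (R := Matrix (Fin d) (Fin d) ℝ)
  · intro Q hQ i _ j _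
    exact abs_le.1 (entry_norm_bound_of_unitary (𝕜 := ℝ) hQ i j)

/-- The normalized Haar measure of the orthogonal group `O(d)`. -/
def orthogonalHaar (d : ℕ) : Measure (Matrix.orthogonalGroup (Fin d) ℝ) :=
  Measure.haarMeasure ⊤

namespace Stiefel

/-- The uniform distribution `σ` on `𝕊_{d,k}`: the law of the first `k` columns of a
Haar-distributed orthogonal matrix. -/
def uniform {d k : ℕ} (h : k ≤ d) : Measure (Stiefel d k) :=
  (orthogonalHaar d).map fun Q => rotate Q (base h)

lemma continuous_rotate_left {d k : ℕ} (E : Stiefel d k) :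
    Continuous fun Q : Matrix.orthogonalGroup (Fin d) ℝ => rotate Q E :=
  Continuous.subtype_mk (by fun_prop) _

lemma continuous_rotate_right {d k : ℕ} (Q : Matrix.orthogonalGroup (Fin d) ℝ) :
    Continuous fun E : Stiefel d k => rotate Q E :=
  Continuous.subtype_mk (continuous_const.matrix_mul continuous_subtype_val) _

instance {d k : ℕ} (h : k ≤ d) : IsProbabilityMeasure (uniform h) := by
  have : IsProbabilityMeasure (orthogonalHaar d) :=
    ⟨Measure.haarMeasure_self (K₀ := (⊤ : TopologicalSpace.PositiveCompacts _))⟩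
  exact Measure.isProbabilityMeasure_map (continuous_rotate_left _).measurable.aemeasurable

/-- `σ` is invariant under `E ↦ Q E` for every orthogonal `Q`. -/
lemma map_rotate_uniform {d k : ℕ} (h : k ≤ d) (Q : Matrix.orthogonalGroup (Fin d) ℝ) :
    (uniform h).map (rotate Q) = uniform h := by
  have hinv : (orthogonalHaar d).map (fun R => Q * R) = orthogonalHaar d :=
    map_mul_left_eq_self (Measure.haarMeasure ⊤) Q
  have hQ : Continuous fun R : Matrix.orthogonalGroup (Fin d) ℝ => Q * R :=
    continuous_const.mul continuous_id
  conv_rhs => rw [uniform, ← hinv]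
  rw [uniform, Measure.map_map (continuous_rotate_right Q).measurable
    (continuous_rotate_left _).measurable,
    Measure.map_map (continuous_rotate_left _).measurable hQ.measurable]
  congr 1
  funext R
  exact Subtype.ext (Matrix.mul_assoc _ _ _).symm

end Stiefel

/-- `M_q(μ) = ∫ ‖x‖^q dμ(x)`, with values in `[0, ∞]`. -/
def absMoment {d : ℕ} (q : ℝ) (μ : Measure (EuclideanSpace ℝ (Fin d))) : ℝ≥0∞ :=
  ∫⁻ x, ‖x‖ₑ ^ q ∂μ

/-- The Wasserstein distance
`W_p(μ, ν) = (inf_π ∫ ‖x - y‖^p dπ(x, y))^(1/p)`, with values in `[0, ∞]`, where `π` runs over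
the measures on the product with marginals `μ` and `ν`. -/
def wasserstein {m : ℕ} (p : ℝ) (μ ν : Measure (EuclideanSpace ℝ (Fin m))) : ℝ≥0∞ :=
  (⨅ π ∈ {π : Measure (EuclideanSpace ℝ (Fin m) × EuclideanSpace ℝ (Fin m)) |
      π.map Prod.fst = μ ∧ π.map Prod.snd = ν},
    ∫⁻ z, ‖z.1 - z.2‖ₑ ^ p ∂π) ^ (1 / p)

/-- The integral projection robust Wasserstein distance
`(∫ W_p(E^⋆_# μ, E^⋆_# ν)^p dσ(E))^(1/p)` over `𝕊_{d,k}`. -/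
def iprw {d k : ℕ} (h : k ≤ d) (p : ℝ) (μ ν : Measure (EuclideanSpace ℝ (Fin d))) : ℝ≥0∞ :=
  (∫⁻ E, wasserstein p (μ.map (Stiefel.proj E)) (ν.map (Stiefel.proj E)) ^ p
    ∂(Stiefel.uniform h)) ^ (1 / p)

/-- The empirical measure `(1/n) ∑ᵢ δ_{xᵢ}`. -/
def empirical {d n : ℕ} (x : Fin n → EuclideanSpace ℝ (Fin d)) :
    Measure (EuclideanSpace ℝ (Fin d)) :=
  (n : ℝ≥0∞)⁻¹ • ∑ i, Measure.dirac (x i)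

open Classical in
/-- The exponent `ζ_{p,q,k}` of the logarithm. -/
def zeta (p q : ℝ) (k : ℕ) : ℝ :=
  if (k : ℝ) = q ∧ q = 2 * p then 2
  else if ((k : ℝ) ≠ 2 * p ∧ (k : ℝ) ≠ p ∧ q = k * p / (k - p)) ∨
      ((k : ℝ) < 2 * p ∧ q = 2 * p) ∨ (q > k ∧ (k : ℝ) = 2 * p) then 1
  else 0

/-- The rate `n^{-[1/((2p) ∨ k) ∧ (1/p - 1/q)]} (log n)^{ζ/p}`. -/
def iprwRate (p q : ℝ) (k n : ℕ) : ℝ :=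
  (n : ℝ) ^ (-(min (1 / max (2 * p) (k : ℝ)) (1 / p - 1 / q))) *
    Real.log n ^ (zeta p q k / p)

end

/-! For a fixed direction `E` the projected measures live on `ℝ^k`, and `x ↦ Eᵀ x` does not increase
norms, so their moments of order `q` are controlled by those of `μ`. It therefore suffices to bound
the expected `W_p ^ p` in dimension `k` uniformly in `E`. Averaging over `E` is then Tonelli, and
the root `1 / p` comes out of the expectation by Jensen (`lintegral_iprw_le`).

For fixed `E`, space is cut into dyadic shells of radius `2 ^ m * s`, with `s` slightly above `M_q ^
(1 / q)`, and each shell into nested cubes. Matching common mass in the finest cells first and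
passing the remainder to coarser ones (`exists_multiscale_coupling`) bounds the cost by a sum over
cells of (diameter)^p times the mass discrepancy. The expected discrepancy of a cell of mass `a` is
at most `min a √(a / n)`. By Cauchy–Schwarz a shell of mass `ε` with `N` cells contributes at most
`min ε √(N ε / n)`. Markov's inequality gives `ε ≲ 2 ^ (-q m)` when `p < q`, and what remains is a
deterministic double series over levels and shells (`rateSum`). For `q = p` the moment sums the
trivial bounds directly.

The level sum is geometric unless `k = 2 p`, and gives `ε (n ε) ^ (-r)` with `r = p / max (2 p) k`.
The shell sum is geometric unless `r = 1 - p / q`. Each critical case whose logarithm cannot be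
avoided costs one factor `log n`, hence `ζ`.

Constants stay independent of `k` for two reasons. A shell has at most `(18 * 2 ^ j) ^ k` cells of
level `j` (`exists_finset_dyadicCell`), and for `k > 2 p` the interpolation at the dominant level
turns such a factor `A ^ (k / 2)` into `A ^ p` (`levelSum_le_of_gt`). Moreover the distances to the
critical cases, when nonzero, are bounded below uniformly in `k` (`exists_gap_dim`,
`exists_gap_moment`). -/

/-! ### Couplings built from nested partitions. -/

section Coupling

variable {X ι : Type*} [MeasurableSpace X] [MeasurableSpace ι] [Countable ι]
  [MeasurableSingletonClass ι]

/-- A finite measure is the sum of its restrictions to the fibers of a map to a countable type. -/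
lemma sum_restrict_fibers (μ : Measure X) {φ : X → ι} (hφ : Measurable φ) :
    Measure.sum (fun i => μ.restrict (φ ⁻¹' {i})) = μ := by
  rw [← Measure.restrict_iUnion]
  · have : ⋃ i, φ ⁻¹' {i} = Set.univ := by ext x; simp
    rw [this, Measure.restrict_univ]
  · intro i j hij
    exact Set.disjoint_left.2 fun x hx hy => hij (by simp_all)
  · exact fun i => hφ (measurableSet_singleton i)

lemma lintegral_comp_countable (μ : Measure X) {φ : X → ι} (hφ : Measurable φ) (f : ι → ℝ≥0∞) :
    ∫⁻ x, f (φ x) ∂μ = ∑' i, f i * μ (φ ⁻¹' {i}) := by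
  rw [← lintegral_map (measurable_of_countable f) hφ, lintegral_countable']
  exact tsum_congr fun i => by rw [Measure.map_apply hφ (measurableSet_singleton i)]

lemma inv_max_mul_add_tsub {a b : ℝ≥0∞} (ha : a ≠ ∞) (hb : b ≠ ∞) (h : a ≠ 0) :
    (max a b)⁻¹ * b + (max a b)⁻¹ * (a - b) = 1 := by
  rw [← mul_add, add_comm, tsub_add_eq_max, ENNReal.inv_mul_cancel]
  · exact fun h0 => h (le_antisymm (h0 ▸ le_max_left a b) bot_le)
  · simp [ha, hb]

lemma inv_max_mul_tsub_mul {a b : ℝ≥0∞} (ha : a ≠ ∞) :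
    (max a b)⁻¹ * (a - b) * a = a - b := by
  rcases le_total a b with h | h
  · simp [tsub_eq_zero_of_le h]
  · rcases eq_or_ne a 0 with rfl | h0
    · simp
    · rw [max_eq_left h, mul_right_comm, ENNReal.inv_mul_cancel h0 ha, one_mul]

/-- The maximal coupling inside the fibers of `φ`: all the common mass of each fiber is matched
inside this fiber, and what is left has the mass `μ Q - ν Q`, respectively `ν Q - μ Q`. -/
theorem exists_fiber_coupling (μ ν : Measure X) [IsFiniteMeasure μ] [IsFiniteMeasure ν]
    {φ : X → ι} (hφ : Measurable φ) :
    ∃ (γ : Measure (X × X)) (μ' ν' : Measure X),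
      γ.map Prod.fst + μ' = μ ∧ γ.map Prod.snd + ν' = ν ∧ (∀ᵐ z ∂γ, φ z.1 = φ z.2) ∧
      (∀ i, μ' (φ ⁻¹' {i}) = μ (φ ⁻¹' {i}) - ν (φ ⁻¹' {i})) ∧
      (∀ i, ν' (φ ⁻¹' {i}) = ν (φ ⁻¹' {i}) - μ (φ ⁻¹' {i})) := by
  set Q : ι → Set X := fun i => φ ⁻¹' {i} with hQ
  have hQm : ∀ i, MeasurableSet (Q i) := fun i => hφ (measurableSet_singleton i)
  set M : ι → ℝ≥0∞ := fun i => max (μ (Q i)) (ν (Q i)) with hM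
  have key : ∀ (ρ τ : Measure X) [IsFiniteMeasure ρ] [IsFiniteMeasure τ],
      Measure.sum (fun i => (max (ρ (Q i)) (τ (Q i)))⁻¹ • (τ (Q i) • ρ.restrict (Q i))) +
      Measure.sum (fun i => ((max (ρ (Q i)) (τ (Q i)))⁻¹ * (ρ (Q i) - τ (Q i))) •
        ρ.restrict (Q i)) = ρ := by
    intro ρ τ _ _
    conv_rhs => rw [← sum_restrict_fibers ρ hφ]
    rw [Measure.sum_add_sum]
    congr 1
    funext i
    rw [smul_smul, ← add_smul]
    by_cases h : ρ (Q i) = 0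
    · have : ρ.restrict (Q i) = 0 := Measure.restrict_eq_zero.2 h
      rw [this, smul_zero]
    · rw [inv_max_mul_add_tsub (measure_ne_top _ _) (measure_ne_top _ _) h, one_smul]
  have key2 : ∀ (ρ τ : Measure X) [IsFiniteMeasure ρ] [IsFiniteMeasure τ] (j : ι),
      Measure.sum (fun i => ((max (ρ (Q i)) (τ (Q i)))⁻¹ * (ρ (Q i) - τ (Q i))) •
        ρ.restrict (Q i)) (Q j) = ρ (Q j) - τ (Q j) := by
    intro ρ τ _ _ j
    rw [Measure.sum_apply _ (hQm j), tsum_eq_single j]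
    · rw [Measure.smul_apply, Measure.restrict_apply_self, smul_eq_mul,
        inv_max_mul_tsub_mul (measure_ne_top _ _)]
    · intro i hi
      have : Q j ∩ Q i = ∅ := by
        ext x
        simp only [hQ, Set.mem_inter_iff, Set.mem_preimage, Set.mem_singleton_iff,
          Set.mem_empty_iff_false, iff_false, not_and]
        exact fun h1 h2 => hi (h2.symm.trans h1)
      rw [Measure.smul_apply, Measure.restrict_apply (hQm j), this, measure_empty, smul_zero]
  -- Dividing the product of the restrictions by the larger mass leaves total mass `min (μ Q) (ν
  -- Q)`. If both masses vanish the factor is `∞`, but it multiplies the zero measure.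
  refine ⟨Measure.sum fun i => (M i)⁻¹ • ((μ.restrict (Q i)).prod (ν.restrict (Q i))),
    Measure.sum fun i => ((max (μ (Q i)) (ν (Q i)))⁻¹ * (μ (Q i) - ν (Q i))) • μ.restrict (Q i),
    Measure.sum fun i => ((max (ν (Q i)) (μ (Q i)))⁻¹ * (ν (Q i) - μ (Q i))) • ν.restrict (Q i),
    ?_, ?_, ?_, key2 μ ν, key2 ν μ⟩
  · conv_rhs => rw [← key μ ν]
    rw [Measure.map_sum measurable_fst.aemeasurable]
    congr 2
    funext i
    rw [Measure.map_smul, Measure.map_fst_prod, Measure.restrict_apply_univ]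
  · conv_rhs => rw [← key ν μ]
    rw [Measure.map_sum measurable_snd.aemeasurable]
    congr 2
    funext i
    rw [Measure.map_smul, Measure.map_snd_prod, Measure.restrict_apply_univ, hM]
    simp only
    rw [max_comm]
  · rw [ae_iff, Measure.sum_apply_of_countable]
    refine ENNReal.tsum_eq_zero.2 fun i => ?_
    rw [Measure.smul_apply, Measure.prod_restrict]
    have h0 : ((μ.prod ν).restrict (Q i ×ˢ Q i)) {z | ¬φ z.1 = φ z.2} = 0 := by
      rw [← ae_iff]
      filter_upwards [ae_restrict_mem ((hQm i).prod (hQm i))] with z hz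
      exact (hz.1 : φ z.1 = i).trans (hz.2 : φ z.2 = i).symm
    rw [h0, smul_zero]

variable {κ : Type*} [Countable κ] [MeasurableSpace κ] [MeasurableSingletonClass κ]

/-- Transport cost bound for a nested sequence `φ 0, φ 1, …, φ J` of partitions: `c j m` bounds the
cost inside a cell of level `j` with label `m`, and `f` bounds the cost between arbitrary points. -/
theorem exists_multiscale_coupling (cost : X → X → ℝ≥0∞) {φ : ℕ → X → ℕ × κ}
    (hφ : ∀ j, Measurable (φ j)) (hfst : ∀ j x, (φ j x).1 = (φ 0 x).1)
    (hnest : ∀ j x y, φ (j + 1) x = φ (j + 1) y → φ j x = φ j y)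
    (c : ℕ → ℕ → ℝ≥0∞) (hc : ∀ j x y, φ j x = φ j y → cost x y ≤ c j (φ 0 x).1)
    (f : ℕ → ℝ≥0∞) (hf : ∀ x y, cost x y ≤ f (φ 0 x).1 + f (φ 0 y).1) (J : ℕ) :
    ∀ (μ ν : Measure X) [IsFiniteMeasure μ] [IsFiniteMeasure ν], μ Set.univ = ν Set.univ →
    ∃ γ : Measure (X × X), γ.map Prod.fst = μ ∧ γ.map Prod.snd = ν ∧
      ∫⁻ z, cost z.1 z.2 ∂γ ≤ (∑' i, c J i.1 * μ (φ J ⁻¹' {i})) +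
        (∑ j ∈ Finset.range J,
          ∑' i, c j i.1 * (μ (φ (j + 1) ⁻¹' {i}) - ν (φ (j + 1) ⁻¹' {i}))) +
        ((∑' i, f i.1 * (μ (φ 0 ⁻¹' {i}) - ν (φ 0 ⁻¹' {i}))) +
          ∑' i, f i.1 * (ν (φ 0 ⁻¹' {i}) - μ (φ 0 ⁻¹' {i}))) := by
  have hle : ∀ {γ : Measure (X × X)} {μ μ' : Measure X}, γ.map Prod.fst + μ' = μ →
      γ.map Prod.fst ≤ μ := fun h => h ▸ Measure.le_add_right le_rfl
  have hmass : ∀ {γ : Measure (X × X)} {μ μ' : Measure X}, γ.map Prod.fst + μ' = μ →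
      γ Set.univ + μ' Set.univ = μ Set.univ := by
    intro γ μ μ' h
    rw [← h, Measure.add_apply, Measure.map_apply measurable_fst MeasurableSet.univ,
      Set.preimage_univ]
  have hmass2 : ∀ {γ : Measure (X × X)} {μ μ' : Measure X}, γ.map Prod.snd + μ' = μ →
      γ Set.univ + μ' Set.univ = μ Set.univ := by
    intro γ μ μ' h
    rw [← h, Measure.add_apply, Measure.map_apply measurable_snd MeasurableSet.univ,
      Set.preimage_univ]
  have hcell : ∀ (J : ℕ) {γ : Measure (X × X)} {μ : Measure X},
      γ.map Prod.fst ≤ μ → (∀ᵐ z ∂γ, φ J z.1 = φ J z.2) →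
      ∫⁻ z, cost z.1 z.2 ∂γ ≤ ∑' i, c J i.1 * μ (φ J ⁻¹' {i}) := by
    intro J γ μ h hae
    calc ∫⁻ z, cost z.1 z.2 ∂γ ≤ ∫⁻ z, c J (φ J z.1).1 ∂γ := by
          refine lintegral_mono_ae ?_
          filter_upwards [hae] with z hz
          rw [hfst J]
          exact hc J _ _ hz
      _ = ∫⁻ x, c J (φ J x).1 ∂(γ.map Prod.fst) := by
          rw [lintegral_map (f := fun x => c J (φ J x).1) _ measurable_fst]
          exact (measurable_of_countable (fun i : ℕ × κ => c J i.1)).comp (hφ J)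
      _ ≤ ∫⁻ x, c J (φ J x).1 ∂μ := lintegral_mono' h le_rfl
      _ = _ := lintegral_comp_countable μ (hφ J) (fun i => c J i.1)
  induction J with
  | zero =>
    intro μ ν _ _ hμν
    obtain ⟨γ, μ', ν', h1, h2, hae, hμ', hν'⟩ := exists_fiber_coupling μ ν (hφ 0)
    have hγfin : γ Set.univ ≠ ∞ := by
      refine ne_top_of_le_ne_top (measure_ne_top μ Set.univ) ?_
      rw [← hmass h1]
      exact le_self_add
    have : IsFiniteMeasure μ' := isFiniteMeasure_of_le μ (h1 ▸ Measure.le_add_left le_rfl)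
    have : IsFiniteMeasure ν' := isFiniteMeasure_of_le ν (h2 ▸ Measure.le_add_left le_rfl)
    have huniv : μ' Set.univ = ν' Set.univ := by
      have h := (hmass h1).trans (hμν.trans (hmass2 h2).symm)
      exact (ENNReal.add_right_inj hγfin).1 h
    -- For a constant map there is a single fiber, and since the remainders have equal mass the
    -- fiber coupling is a full coupling.
    obtain ⟨γ₂, μ'', ν'', h3, h4, -, hμ'', hν''⟩ :=
      exists_fiber_coupling μ' ν' (φ := fun _ : X => ()) measurable_const
    have hpre : (fun _ : X => ()) ⁻¹' {()} = Set.univ := by ext; simp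
    have hz1 : μ'' = 0 := by
      have := hμ'' ()
      rw [hpre, huniv, tsub_self] at this
      exact Measure.measure_univ_eq_zero.1 this
    have hz2 : ν'' = 0 := by
      have := hν'' ()
      rw [hpre, huniv, tsub_self] at this
      exact Measure.measure_univ_eq_zero.1 this
    rw [hz1, add_zero] at h3
    rw [hz2, add_zero] at h4
    refine ⟨γ + γ₂, ?_, ?_, ?_⟩
    · rw [Measure.map_add _ _ measurable_fst, h3, h1]
    · rw [Measure.map_add _ _ measurable_snd, h4, h2]
    · rw [lintegral_add_measure, Finset.sum_range_zero, add_zero]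
      refine add_le_add (hcell 0 (hle h1) hae) ?_
      have hfm : Measurable fun x => f (φ 0 x).1 :=
        (measurable_of_countable (fun i : ℕ × κ => f i.1)).comp (hφ 0)
      calc ∫⁻ z, cost z.1 z.2 ∂γ₂ ≤ ∫⁻ z, f (φ 0 z.1).1 + f (φ 0 z.2).1 ∂γ₂ :=
            lintegral_mono fun z => hf _ _
        _ = ∫⁻ z, f (φ 0 z.1).1 ∂γ₂ + ∫⁻ z, f (φ 0 z.2).1 ∂γ₂ :=
            lintegral_add_left (hfm.comp measurable_fst) _
        _ = ∫⁻ x, f (φ 0 x).1 ∂μ' + ∫⁻ x, f (φ 0 x).1 ∂ν' := by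
            rw [← h3, ← h4, lintegral_map hfm measurable_fst, lintegral_map hfm measurable_snd]
        _ = _ := by
            rw [lintegral_comp_countable μ' (hφ 0) (fun i => f i.1),
              lintegral_comp_countable ν' (hφ 0) (fun i => f i.1)]
            simp only [hμ', hν']
  | succ J ih =>
    intro μ ν _ _ hμν
    -- The finest level is matched first; the induction hypothesis transports the remainders through
    -- the coarser levels.
    obtain ⟨γ, μ', ν', h1, h2, hae, hμ', hν'⟩ := exists_fiber_coupling μ ν (hφ (J + 1))
    have hγfin : γ Set.univ ≠ ∞ := by
      refine ne_top_of_le_ne_top (measure_ne_top μ Set.univ) ?_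
      rw [← hmass h1]
      exact le_self_add
    have : IsFiniteMeasure γ := ⟨hγfin.lt_top⟩
    have : IsFiniteMeasure μ' := isFiniteMeasure_of_le μ (h1 ▸ Measure.le_add_left le_rfl)
    have : IsFiniteMeasure ν' := isFiniteMeasure_of_le ν (h2 ▸ Measure.le_add_left le_rfl)
    have huniv : μ' Set.univ = ν' Set.univ := by
      have h := (hmass h1).trans (hμν.trans (hmass2 h2).symm)
      exact (ENNReal.add_right_inj hγfin).1 h
    have hchain : ∀ j ≤ J + 1, ∀ x y, φ (J + 1) x = φ (J + 1) y → φ j x = φ j y := by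
      intro j hj x y
      induction hj using Nat.decreasingInduction with
      | self => exact id
      | of_succ k hk ihk => exact fun h => hnest k x y (ihk h)
    -- The matched part has the same mass under both marginals on every coarser cell, so it cancels
    -- in the differences.
    have hsub : ∀ j ≤ J + 1, ∀ i, μ' (φ j ⁻¹' {i}) - ν' (φ j ⁻¹' {i}) =
        μ (φ j ⁻¹' {i}) - ν (φ j ⁻¹' {i}) ∧ ν' (φ j ⁻¹' {i}) - μ' (φ j ⁻¹' {i}) =
        ν (φ j ⁻¹' {i}) - μ (φ j ⁻¹' {i}) := by
      intro j hj i
      have hm : MeasurableSet (φ j ⁻¹' {i}) := hφ j (measurableSet_singleton i)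
      have e1 : μ (φ j ⁻¹' {i}) = γ (Prod.fst ⁻¹' (φ j ⁻¹' {i})) + μ' (φ j ⁻¹' {i}) := by
        conv_lhs => rw [← h1]
        rw [Measure.add_apply, Measure.map_apply measurable_fst hm]
      have e2 : ν (φ j ⁻¹' {i}) = γ (Prod.fst ⁻¹' (φ j ⁻¹' {i})) + ν' (φ j ⁻¹' {i}) := by
        conv_lhs => rw [← h2]
        rw [Measure.add_apply, Measure.map_apply measurable_snd hm]
        congr 1
        refine measure_congr ?_
        filter_upwards [hae] with z hz
        have := hchain j hj _ _ hz
        refine propext (show φ j z.2 = i ↔ φ j z.1 = i from ?_)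
        rw [this]
      have hg : γ (Prod.fst ⁻¹' (φ j ⁻¹' {i})) ≠ ∞ := measure_ne_top _ _
      rw [e1, e2]
      exact ⟨(ENNReal.add_sub_add_eq_sub_left hg).symm, (ENNReal.add_sub_add_eq_sub_left hg).symm⟩
    obtain ⟨γ₂, h3, h4, hb⟩ := ih μ' ν' huniv
    refine ⟨γ + γ₂, ?_, ?_, ?_⟩
    · rw [Measure.map_add _ _ measurable_fst, h3, h1]
    · rw [Measure.map_add _ _ measurable_snd, h4, h2]
    · rw [lintegral_add_measure]
      refine (add_le_add (hcell (J + 1) (hle h1) hae) hb).trans ?_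
      rw [Finset.sum_range_succ]
      -- The cost depends only on the label shared by all levels, so the remainder may be counted by
      -- cells of level `J + 1`, where its mass is a known positive part.
      have hJ : ∑' i, c J i.1 * μ' (φ J ⁻¹' {i}) = ∑' i, c J i.1 *
          (μ (φ (J + 1) ⁻¹' {i}) - ν (φ (J + 1) ⁻¹' {i})) := by
        rw [← lintegral_comp_countable μ' (hφ J) (fun i => c J i.1)]
        simp only [← hμ']
        rw [← lintegral_comp_countable μ' (hφ (J + 1)) (fun i => c J i.1)]
        exact lintegral_congr fun x => by rw [hfst J, hfst (J + 1)]
      have hS : ∑ j ∈ Finset.range J,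
          ∑' i, c j i.1 * (μ' (φ (j + 1) ⁻¹' {i}) - ν' (φ (j + 1) ⁻¹' {i})) =
          ∑ j ∈ Finset.range J,
          ∑' i, c j i.1 * (μ (φ (j + 1) ⁻¹' {i}) - ν (φ (j + 1) ⁻¹' {i})) := by
        refine Finset.sum_congr rfl fun j hj => tsum_congr fun i => ?_
        have := Finset.mem_range.1 hj
        rw [(hsub (j + 1) (by omega) i).1]
      rw [hJ, hS]
      simp only [(hsub 0 (Nat.zero_le _) _).1, (hsub 0 (Nat.zero_le _) _).2]
      refine le_of_eq ?_
      ring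

end Coupling

/-! ### Dyadic shells and cubes, and their number. -/

section Cells

variable {k : ℕ}

/-- The index of the dyadic shell of `x` at scale `s`: the least `m` with `‖x‖ ≤ 2 ^ m * s`. -/
noncomputable def shell (s : ℝ) (x : EuclideanSpace ℝ (Fin k)) : ℕ := Nat.clog 2 ⌈‖x‖ / s⌉₊

/-- The dyadic cell of `x` at level `j`: its shell at level `0`; at higher levels the shell is cut
into cubes of diameter at most `2 ^ (m - j) * s`. -/
noncomputable def dyadicCell (s : ℝ) (j : ℕ) (x : EuclideanSpace ℝ (Fin k)) : ℕ × (Fin k → ℤ) :=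
  (shell s x, if j = 0 then 0 else fun i => ⌊2 ^ j * (√k * x i / (2 ^ shell s x * s))⌋)

lemma measurable_shell (s : ℝ) : Measurable (shell (k := k) s) :=
  (measurable_of_countable (Nat.clog 2)).comp
    (Nat.measurable_ceil.comp (measurable_norm.div_const s))

lemma measurable_dyadicCell (s : ℝ) (j : ℕ) : Measurable (dyadicCell (k := k) s j) := by
  refine (measurable_shell s).prodMk ?_
  split_ifs
  · exact measurable_const
  · refine measurable_pi_lambda _ fun i => Int.measurable_floor.comp ?_
    have h1 : Measurable fun x : EuclideanSpace ℝ (Fin k) => (2 : ℝ) ^ shell s x :=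
      (measurable_of_countable (fun m : ℕ => (2 : ℝ) ^ m)).comp (measurable_shell s)
    have h2 : Measurable fun x : EuclideanSpace ℝ (Fin k) => x i := by fun_prop
    exact ((h2.const_mul _).div (h1.mul_const s)).const_mul _

lemma norm_le_of_shell {s : ℝ} (hs : 0 < s) (x : EuclideanSpace ℝ (Fin k)) :
    ‖x‖ ≤ 2 ^ shell s x * s := by
  rw [← div_le_iff₀ hs]
  refine (Nat.le_ceil _).trans ?_
  have := (Nat.clog_le_iff_le_pow (b := 2) (by norm_num) (x := ⌈‖x‖ / s⌉₊)).1 le_rfl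
  exact_mod_cast this

lemma two_pow_shell_le (s : ℝ) (x : EuclideanSpace ℝ (Fin k)) :
    (2 : ℝ) ^ shell s x ≤ max 1 (2 * ‖x‖ / s) := by
  rcases h : shell s x with _ | m
  · simp
  · have h1 : 2 ^ m < ⌈‖x‖ / s⌉₊ :=
      (Nat.lt_clog_iff_pow_lt (by norm_num)).1 (by rw [shell] at h; omega)
    have h2 := Nat.lt_ceil.1 h1
    push_cast at h2
    refine le_max_of_le_right ?_
    rw [pow_succ, mul_comm, mul_div_assoc]
    linarith

/-- Halving an integer label with rounding down recovers the label one level coarser; level `0`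
keeps only the shell. -/
lemma dyadicCell_nested (s : ℝ) (j : ℕ) (x y : EuclideanSpace ℝ (Fin k))
    (h : dyadicCell s (j + 1) x = dyadicCell s (j + 1) y) : dyadicCell s j x = dyadicCell s j y := by
  have h1 : shell s x = shell s y := congrArg Prod.fst h
  refine Prod.ext h1 ?_
  by_cases hj : j = 0
  · simp [dyadicCell, hj]
  · have h2 := congrArg Prod.snd h
    simp only [dyadicCell, hj, if_false, Nat.succ_ne_zero] at h2 ⊢
    funext i
    have h3 := congrFun h2 i
    have key : ∀ t : ℝ, ⌊2 ^ j * t⌋ = ⌊2 ^ (j + 1) * t⌋ / (2 : ℕ) := by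
      intro t
      rw [← Int.floor_div_natCast]
      congr 1
      rw [pow_succ]
      push_cast
      ring
    rw [key, key, h3]

/-- For `j ≥ 1` a cell lies in a cube of side `R / (2 ^ j * √k)`, with diagonal `R / 2 ^ j`. The
factor `2` is needed only at level `0`, where the cell is a whole shell. -/
lemma norm_sub_le_of_dyadicCell_eq {s : ℝ} (hs : 0 < s) (j : ℕ) (x y : EuclideanSpace ℝ (Fin k))
    (h : dyadicCell s j x = dyadicCell s j y) :
    ‖x - y‖ ≤ 2 * (2 ^ shell s x * s / 2 ^ j) := by
  have h1 : shell s x = shell s y := congrArg Prod.fst h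
  by_cases hj : j = 0
  · subst hj
    have hx := norm_le_of_shell hs x
    have hy := norm_le_of_shell hs y
    rw [← h1] at hy
    have := norm_sub_le x y
    simp only [pow_zero, div_one]
    linarith
  · rcases Nat.eq_zero_or_pos k with rfl | hk
    · have : x - y = 0 := Subsingleton.elim _ _
      rw [this, norm_zero]
      positivity
    have h2 := congrArg Prod.snd h
    simp only [dyadicCell, hj, if_false] at h2
    set R : ℝ := 2 ^ shell s x * s with hR
    have hRpos : 0 < R := by positivity
    have hkpos : (0 : ℝ) < k := by exact_mod_cast hk
    have hkp : 0 < √(k : ℝ) := Real.sqrt_pos.2 hkpos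
    have hcoord : ∀ i, ‖(x - y) i‖ ^ 2 ≤ (R / 2 ^ j) ^ 2 / k := by
      intro i
      have h3 := congrFun h2 i
      rw [← h1, ← hR] at h3
      have h4 := Int.abs_sub_lt_one_of_floor_eq_floor h3
      have h5 : 2 ^ j * (√k * x i / R) - 2 ^ j * (√k * y i / R) =
          (√k * 2 ^ j / R) * (x - y) i := by
        simp only [PiLp.sub_apply]
        ring
      rw [h5, abs_mul, abs_of_pos (by positivity)] at h4
      have h6 : |(x - y) i| ≤ (R / 2 ^ j) / √k := by
        rw [le_div_iff₀ hkp, le_div_iff₀ (by positivity)]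
        have : √k * 2 ^ j / R * |(x - y).ofLp i| = (|(x - y) i| * √k * 2 ^ j) / R := by ring
        rw [this, div_lt_one hRpos] at h4
        exact h4.le
      calc ‖(x - y) i‖ ^ 2 ≤ ((R / 2 ^ j) / √k) ^ 2 := by
            rw [Real.norm_eq_abs]
            gcongr
        _ = _ := by rw [div_pow, Real.sq_sqrt hkpos.le]
    have h7 : ‖x - y‖ ^ 2 ≤ (R / 2 ^ j) ^ 2 := by
      rw [EuclideanSpace.norm_sq_eq]
      refine (Finset.sum_le_sum fun i _ => hcoord i).trans (le_of_eq ?_)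
      rw [Finset.sum_const, Finset.card_univ, Fintype.card_fin, nsmul_eq_mul]
      field_simp
    have h8 : ‖x - y‖ ≤ R / 2 ^ j := le_of_sq_le_sq h7 (by positivity)
    have : 0 < R / 2 ^ j := by positivity
    linarith

lemma sum_geometric_natAbs_le {r : ℝ} (h0 : 0 ≤ r) (h1 : r < 1) (s : Finset ℤ) :
    ∑ z ∈ s, r ^ z.natAbs ≤ 2 * (1 - r)⁻¹ := by
  obtain ⟨K, hK⟩ : ∃ K : ℕ, ∀ z ∈ s, z.natAbs < K :=
    ⟨s.sup Int.natAbs + 1, fun z hz => Nat.lt_succ_of_le (Finset.le_sup (f := Int.natAbs) hz)⟩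
  have hsub : s ⊆ (Finset.range K).image (fun n : ℕ => (n : ℤ)) ∪
      (Finset.range K).image (fun n : ℕ => -(n : ℤ)) := by
    intro z hz
    have := hK z hz
    rcases Int.natAbs_eq z with h | h
    · exact Finset.mem_union_left _ (Finset.mem_image.2 ⟨z.natAbs, Finset.mem_range.2 this, h.symm⟩)
    · exact Finset.mem_union_right _ (Finset.mem_image.2 ⟨z.natAbs, Finset.mem_range.2 this, h.symm⟩)
  have hgeo : ∑ n ∈ Finset.range K, r ^ n ≤ (1 - r)⁻¹ := by
    rw [← tsum_geometric_of_lt_one h0 h1]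
    exact (summable_geometric_of_lt_one h0 h1).sum_le_tsum _ fun i _ => pow_nonneg h0 i
  calc ∑ z ∈ s, r ^ z.natAbs ≤ _ :=
        Finset.sum_le_sum_of_subset_of_nonneg hsub fun i _ _ => pow_nonneg h0 _
    _ ≤ ∑ z ∈ (Finset.range K).image (fun n : ℕ => (n : ℤ)), r ^ z.natAbs +
        ∑ z ∈ (Finset.range K).image (fun n : ℕ => -(n : ℤ)), r ^ z.natAbs := by
        rw [← Finset.sum_union_inter]
        exact le_add_of_nonneg_right (Finset.sum_nonneg fun i _ => pow_nonneg h0 _)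
    _ = ∑ n ∈ Finset.range K, r ^ n + ∑ n ∈ Finset.range K, r ^ n := by
        rw [Finset.sum_image (by intro a _ b _ h; simpa using h),
          Finset.sum_image (by intro a _ b _ h; simpa using h)]
        simp
    _ ≤ _ := by linarith

/-- The number of integer points in the `ℓ¹` ball of radius `k * T` in dimension `k` is at most
`(6 (T + 1)) ^ k`. -/
lemma exists_finset_l1_ball (k : ℕ) {T : ℕ} (hT : 0 < T) :
    ∃ F : Finset (Fin k → ℤ), (F.card : ℝ) ≤ (6 * (T + 1)) ^ k ∧
      ∀ z : Fin k → ℤ, ∑ i, (z i).natAbs ≤ k * T → z ∈ F := by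
  classical
  set G : Finset ℤ := Finset.Icc (-((k * T : ℕ) : ℤ)) ((k * T : ℕ) : ℤ) with hG
  set F : Finset (Fin k → ℤ) := (Fintype.piFinset fun _ : Fin k => G).filter
    fun z => ∑ i, (z i).natAbs ≤ k * T with hF
  refine ⟨F, ?_, ?_⟩
  · have hTpos : (0 : ℝ) < T := by exact_mod_cast hT
    -- Exponential weights: every point of the ball has weight at least `r ^ (k * T)`, while all
    -- weights sum to at most `(2 / (1 - r)) ^ k`. This `r` gives `1 / (1 - r) = T + 1` and `r⁻¹ ^ T
    -- = (1 + 1 / T) ^ T ≤ 3`.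
    set r : ℝ := T / (T + 1) with hr
    have hr0 : 0 < r := by positivity
    have hr1 : r < 1 := by rw [hr, div_lt_one (by positivity)]; linarith
    have hinv : (1 - r)⁻¹ = T + 1 := by
      rw [hr]; field_simp; ring
    have hrT : r⁻¹ ^ T ≤ 3 := by
      have h1 : r⁻¹ ≤ Real.exp (1 / T) := by
        refine le_trans (le_of_eq ?_) (Real.add_one_le_exp _)
        rw [hr]; field_simp; ring
      calc r⁻¹ ^ T ≤ Real.exp (1 / T) ^ T := by gcongr
        _ = Real.exp 1 := by rw [← Real.exp_nat_mul]; congr 1; field_simp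
        _ ≤ 3 := by linarith [Real.exp_one_lt_d9]
    have hone : ∀ z ∈ F, (1 : ℝ) ≤ r⁻¹ ^ (k * T) * ∏ i, r ^ (z i).natAbs := by
      intro z hz
      rw [Finset.prod_pow_eq_pow_sum]
      have hle : r ^ (k * T) ≤ r ^ ∑ i, (z i).natAbs :=
        pow_le_pow_of_le_one hr0.le hr1.le (Finset.mem_filter.1 hz).2
      calc (1 : ℝ) = r⁻¹ ^ (k * T) * r ^ (k * T) := by
            rw [← mul_pow, inv_mul_cancel₀ hr0.ne', one_pow]
        _ ≤ _ := by gcongr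
    calc (F.card : ℝ) = ∑ z ∈ F, (1 : ℝ) := by simp
      _ ≤ ∑ z ∈ F, r⁻¹ ^ (k * T) * ∏ i, r ^ (z i).natAbs := Finset.sum_le_sum hone
      _ ≤ ∑ z ∈ Fintype.piFinset fun _ : Fin k => G, r⁻¹ ^ (k * T) * ∏ i, r ^ (z i).natAbs :=
          Finset.sum_le_sum_of_subset_of_nonneg (Finset.filter_subset _ _)
            fun z _ _ => by positivity
      _ = r⁻¹ ^ (k * T) * ∏ i : Fin k, ∑ z ∈ G, r ^ z.natAbs := by
          rw [← Finset.mul_sum, Finset.prod_univ_sum]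
      _ ≤ 3 ^ k * (2 * (T + 1)) ^ k := by
          have h1 : r⁻¹ ^ (k * T) ≤ 3 ^ k := by
            rw [mul_comm, pow_mul]
            gcongr
          have h2 : ∏ i : Fin k, ∑ z ∈ G, r ^ z.natAbs ≤ (2 * ((T : ℝ) + 1)) ^ k := by
            rw [Finset.prod_const, Finset.card_univ, Fintype.card_fin, ← hinv]
            refine pow_le_pow_left₀ (Finset.sum_nonneg fun z _ => by positivity) ?_ _
            exact sum_geometric_natAbs_le hr0.le hr1 G
          exact mul_le_mul h1 h2 (Finset.prod_nonneg fun i _ =>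
            Finset.sum_nonneg fun z _ => by positivity) (by positivity)
      _ = _ := by rw [← mul_pow]; congr 1; ring
  · intro z hz
    refine Finset.mem_filter.2 ⟨Fintype.mem_piFinset.2 fun i => ?_, hz⟩
    have : (z i).natAbs ≤ k * T :=
      (Finset.single_le_sum (f := fun i => (z i).natAbs) (fun _ _ => Nat.zero_le _)
        (Finset.mem_univ i)).trans hz
    rw [hG, Finset.mem_Icc]
    omega

/-- At level `j`, each shell consists of at most `(18 * 2 ^ j) ^ k` cells. -/
lemma exists_finset_dyadicCell (k : ℕ) {s : ℝ} (hs : 0 < s) (j : ℕ) :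
    ∃ F : Finset (Fin k → ℤ), (F.card : ℝ) ≤ (18 * 2 ^ j) ^ k ∧
      ∀ x : EuclideanSpace ℝ (Fin k), (dyadicCell s j x).2 ∈ F := by
  -- By Cauchy–Schwarz the rescaled vector has `ℓ¹` norm at most `k * 2 ^ j`, and rounding adds at
  -- most `k`. The count is then `6 (2 ^ (j + 1) + 1) ≤ 18 * 2 ^ j` per coordinate.
  obtain ⟨F, hF, hmem⟩ := exists_finset_l1_ball k (T := 2 ^ (j + 1)) (by positivity)
  refine ⟨F, hF.trans ?_, fun x => hmem _ ?_⟩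
  · have : (1 : ℝ) ≤ 2 ^ j := one_le_pow₀ (by norm_num)
    refine pow_le_pow_left₀ (by positivity) ?_ k
    push_cast
    rw [pow_succ]
    linarith
  · by_cases hj : j = 0
    · simp [dyadicCell, hj]
    simp only [dyadicCell, hj, if_false]
    set R : ℝ := 2 ^ shell s x * s with hR
    have hRpos : 0 < R := by positivity
    have hfl : ∀ t : ℝ, ((⌊t⌋.natAbs : ℕ) : ℝ) ≤ |t| + 1 := by
      intro t
      rw [Nat.cast_natAbs, Int.cast_abs, abs_le]
      have h1 := Int.floor_le t
      have h2 := Int.lt_floor_add_one t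
      have h3 := neg_abs_le t
      have h4 := le_abs_self t
      constructor <;> linarith
    have hl1 : ∑ i, |x i| ≤ √k * R := by
      have h1 := sq_sum_le_card_mul_sum_sq (s := Finset.univ) (f := fun i => |x i|)
      have h2 : ∑ i, |x i| ^ 2 = ‖x‖ ^ 2 := by
        rw [EuclideanSpace.norm_sq_eq]
        rfl
      rw [h2, Finset.card_univ, Fintype.card_fin] at h1
      refine le_of_sq_le_sq (h1.trans ?_) (by positivity)
      rw [mul_pow, Real.sq_sqrt (Nat.cast_nonneg k)]
      have := norm_le_of_shell hs x
      gcongr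
    have hreal : ((∑ i, ⌊2 ^ j * (√k * x i / R)⌋.natAbs : ℕ) : ℝ) ≤ ((k * 2 ^ (j + 1) : ℕ) : ℝ) := by
      push_cast
      calc ∑ i, ((⌊2 ^ j * (√k * x i / R)⌋.natAbs : ℕ) : ℝ)
          ≤ ∑ i, (2 ^ j * √k / R * |x i| + 1) := by
            refine Finset.sum_le_sum fun i _ => (hfl _).trans (le_of_eq ?_)
            rw [show 2 ^ j * (√k * x i / R) = 2 ^ j * √k / R * x i by ring, abs_mul,
              abs_of_nonneg (by positivity : 0 ≤ 2 ^ j * √k / R)]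
        _ = 2 ^ j * √k / R * ∑ i, |x i| + k := by
            rw [Finset.sum_add_distrib, ← Finset.mul_sum]
            simp
        _ ≤ 2 ^ j * √k / R * (√k * R) + k := by gcongr
        _ = 2 ^ j * k + k := by
            have := Real.mul_self_sqrt (Nat.cast_nonneg (α := ℝ) k)
            rw [show 2 ^ j * √k / R * (√k * R) = 2 ^ j * (√k * √k) * (R / R) by ring, this,
              div_self hRpos.ne', mul_one]
        _ ≤ k * 2 ^ (j + 1) := by
            have : (1 : ℝ) ≤ 2 ^ j := one_le_pow₀ (by norm_num)
            rw [pow_succ]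
            nlinarith [Nat.cast_nonneg (α := ℝ) k]
    exact_mod_cast hreal

end Cells

/-! ### Expected deviation of empirical frequencies. -/

section EmpiricalDeviation

variable {d n : ℕ}

lemma empirical_apply (x : Fin n → EuclideanSpace ℝ (Fin d)) {A : Set (EuclideanSpace ℝ (Fin d))}
    (hA : MeasurableSet A) :
    empirical x A = (n : ℝ≥0∞)⁻¹ * ∑ i, A.indicator 1 (x i) := by
  simp [empirical, hA]

lemma isProbabilityMeasure_empirical (hn : 0 < n) (x : Fin n → EuclideanSpace ℝ (Fin d)) :
    IsProbabilityMeasure (empirical x) := by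
  refine ⟨?_⟩
  rw [empirical_apply x MeasurableSet.univ]
  simp only [Set.indicator_univ, Pi.one_apply, Finset.sum_const, Finset.card_univ, Fintype.card_fin,
    nsmul_eq_mul, mul_one]
  exact ENNReal.inv_mul_cancel (by exact_mod_cast hn.ne') (by simp)

lemma measurable_empirical_apply {A : Set (EuclideanSpace ℝ (Fin d))} (hA : MeasurableSet A) :
    Measurable fun x : Fin n → EuclideanSpace ℝ (Fin d) => empirical x A := by
  simp only [empirical_apply _ hA]
  refine (Finset.measurable_sum _ fun i _ => ?_).const_mul _
  exact (measurable_one.indicator hA).comp (measurable_pi_apply i)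

lemma indicator_one_nonneg {X : Type*} (A : Set X) (y : X) :
    0 ≤ A.indicator (1 : X → ℝ) y :=
  Set.indicator_nonneg (fun _ _ => zero_le_one) y

lemma empirical_apply_eq_ofReal (x : Fin n → EuclideanSpace ℝ (Fin d))
    {A : Set (EuclideanSpace ℝ (Fin d))} (hA : MeasurableSet A) :
    empirical x A = ENNReal.ofReal ((n : ℝ)⁻¹ * ∑ i, A.indicator (1 : EuclideanSpace ℝ (Fin d) → ℝ) (x i)) := by
  rcases Nat.eq_zero_or_pos n with rfl | hn
  · simp [empirical_apply x hA]
  rw [empirical_apply x hA, ENNReal.ofReal_mul (by positivity),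
    ENNReal.ofReal_inv_of_pos (by exact_mod_cast hn), ENNReal.ofReal_natCast,
    ENNReal.ofReal_sum_of_nonneg fun i _ => indicator_one_nonneg A _]
  congr 2
  funext i
  by_cases h : x i ∈ A <;> simp [h]

variable (μ : Measure (EuclideanSpace ℝ (Fin d))) [IsProbabilityMeasure μ]

lemma lintegral_empirical_apply (hn : 0 < n) {A : Set (EuclideanSpace ℝ (Fin d))}
    (hA : MeasurableSet A) :
    ∫⁻ x, empirical x A ∂(Measure.pi fun _ : Fin n => μ) = μ A := by
  simp only [empirical_apply _ hA]
  have hm : ∀ i, Measurable fun x : Fin n → EuclideanSpace ℝ (Fin d) =>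
      A.indicator (1 : EuclideanSpace ℝ (Fin d) → ℝ≥0∞) (x i) := fun i =>
    (measurable_one.indicator hA).comp (measurable_pi_apply i)
  rw [lintegral_const_mul _ (Finset.measurable_sum _ fun i _ => hm i),
    lintegral_finsetSum _ fun i _ => hm i]
  have h1 : ∀ i, ∫⁻ x, A.indicator (1 : EuclideanSpace ℝ (Fin d) → ℝ≥0∞) (x i) ∂(Measure.pi fun _ : Fin n => μ) = μ A := by
    intro i
    rw [← lintegral_indicator_one hA]
    exact (measurePreserving_eval (fun _ : Fin n => μ) i).lintegral_comp
      (measurable_one.indicator hA)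
  simp only [h1, Finset.sum_const, Finset.card_univ, Fintype.card_fin, nsmul_eq_mul]
  rw [← mul_assoc, ENNReal.inv_mul_cancel (by exact_mod_cast hn.ne') (by simp), one_mul]

/-- The mean absolute deviation of the empirical frequency of `A` is at most `√(μ A / n)`. -/
lemma lintegral_abs_frequency_sub_le (hn : 0 < n) {A : Set (EuclideanSpace ℝ (Fin d))}
    (hA : MeasurableSet A) :
    ∫⁻ x, ENNReal.ofReal |(n : ℝ)⁻¹ * ∑ i, A.indicator (1 : EuclideanSpace ℝ (Fin d) → ℝ) (x i) - μ.real A|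
      ∂(Measure.pi fun _ : Fin n => μ) ≤ ENNReal.ofReal √(μ.real A / n) := by
  set P := Measure.pi fun _ : Fin n => μ with hP
  set g : (Fin n → EuclideanSpace ℝ (Fin d)) → ℝ := fun x =>
    (n : ℝ)⁻¹ * ∑ i, A.indicator (1 : EuclideanSpace ℝ (Fin d) → ℝ) (x i) with hg
  have hnr : (0 : ℝ) < n := by exact_mod_cast hn
  have hf : MemLp (A.indicator (1 : EuclideanSpace ℝ (Fin d) → ℝ)) 2 μ := memLp_indicator_const 2 hA 1 (by simp)
  have hfi : ∀ i, MemLp (fun x : Fin n → EuclideanSpace ℝ (Fin d) =>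
      A.indicator (1 : EuclideanSpace ℝ (Fin d) → ℝ) (x i)) 2 P := fun i =>
    hf.comp_measurePreserving (measurePreserving_eval (fun _ : Fin n => μ) i)
  have hgL : MemLp g 2 P := (memLp_finsetSum _ fun i _ => hfi i).const_mul _
  have hmean : P[g] = μ.real A := by
    rw [hg, integral_const_mul, integral_finsetSum _ fun i _ => (hfi i).integrable (by norm_num)]
    have h1 : ∀ i, ∫ x, A.indicator (1 : EuclideanSpace ℝ (Fin d) → ℝ) (x i) ∂P = μ.real A := by
      intro i
      rw [← integral_indicator_one hA]
      exact integral_comp_eval (μ := fun _ : Fin n => μ) (i := i) hf.aestronglyMeasurable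
    simp only [h1, Finset.sum_const, Finset.card_univ, Fintype.card_fin, nsmul_eq_mul]
    rw [← mul_assoc, inv_mul_cancel₀ hnr.ne', one_mul]
  have hvar : Var[g; P] ≤ μ.real A / n := by
    have h1 : g = fun x => (n : ℝ)⁻¹ * (∑ i, fun x : Fin n → EuclideanSpace ℝ (Fin d) =>
        A.indicator (1 : EuclideanSpace ℝ (Fin d) → ℝ) (x i)) x := by
      funext x
      simp [hg, Finset.sum_apply]
    rw [h1, variance_const_mul, hP, variance_sum_pi fun _ => hf]
    have h2 : Var[A.indicator (1 : EuclideanSpace ℝ (Fin d) → ℝ); μ] ≤ μ.real A := by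
      refine (variance_le_expectation_sq hf.aestronglyMeasurable).trans (le_of_eq ?_)
      rw [← integral_indicator_one hA]
      congr 1
      funext x
      by_cases h : x ∈ A <;> simp [h]
    simp only [Finset.sum_const, Finset.card_univ, Fintype.card_fin, nsmul_eq_mul]
    calc (n : ℝ)⁻¹ ^ 2 * (n * Var[A.indicator (1 : EuclideanSpace ℝ (Fin d) → ℝ); μ])
        ≤ (n : ℝ)⁻¹ ^ 2 * (n * μ.real A) := by gcongr
      _ = _ := by field_simp
  have hdL : MemLp (fun x => |g x - μ.real A|) 2 P := (hgL.sub (memLp_const _)).abs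
  -- Jensen for the square, read off from the nonnegative variance of the absolute deviation.
  have hsq : (∫ x, |g x - μ.real A| ∂P) ^ 2 ≤ Var[g; P] := by
    have h1 := variance_nonneg (fun x => |g x - μ.real A|) P
    rw [variance_eq_sub hdL] at h1
    rw [variance_eq_integral hgL.aestronglyMeasurable.aemeasurable, hmean]
    simpa [Pi.pow_apply, sq_abs] using h1
  rw [← ofReal_integral_eq_lintegral_ofReal (hdL.integrable (by norm_num))
    (ae_of_all _ fun x => abs_nonneg _)]
  exact ENNReal.ofReal_le_ofReal (Real.le_sqrt_of_sq_le (hsq.trans hvar))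

/-- The mass itself is the better bound for cells of mass below `1 / n`, the fluctuation for heavier
ones. -/
lemma lintegral_tsub_empirical_le (hn : 0 < n) {A : Set (EuclideanSpace ℝ (Fin d))}
    (hA : MeasurableSet A) :
    ∫⁻ x, (μ A - empirical x A) ∂(Measure.pi fun _ : Fin n => μ) ≤
      ENNReal.ofReal (min (μ.real A) √(μ.real A / n)) := by
  rw [ENNReal.ofReal_min, ofReal_measureReal]
  refine le_min ?_ ?_
  · refine (lintegral_mono fun x => tsub_le_self).trans ?_
    simp
  · refine le_trans (lintegral_mono fun x => ?_) (lintegral_abs_frequency_sub_le μ hn hA)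
    rw [empirical_apply_eq_ofReal x hA, ← ofReal_measureReal (μ := μ),
      ← ENNReal.ofReal_sub _ (mul_nonneg (by positivity) (Finset.sum_nonneg fun i _ =>
        indicator_one_nonneg A _))]
    rw [abs_sub_comm]
    exact ENNReal.ofReal_le_ofReal (le_abs_self _)

lemma lintegral_empirical_tsub_le (hn : 0 < n) {A : Set (EuclideanSpace ℝ (Fin d))}
    (hA : MeasurableSet A) :
    ∫⁻ x, (empirical x A - μ A) ∂(Measure.pi fun _ : Fin n => μ) ≤
      ENNReal.ofReal (min (μ.real A) √(μ.real A / n)) := by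
  rw [ENNReal.ofReal_min, ofReal_measureReal]
  refine le_min ?_ ?_
  · refine (lintegral_mono fun x => tsub_le_self).trans ?_
    rw [lintegral_empirical_apply μ hn hA]
  · refine le_trans (lintegral_mono fun x => ?_) (lintegral_abs_frequency_sub_le μ hn hA)
    rw [empirical_apply_eq_ofReal x hA, ← ofReal_measureReal (μ := μ),
      ← ENNReal.ofReal_sub _ measureReal_nonneg]
    exact ENNReal.ofReal_le_ofReal (le_abs_self _)

variable {κ : Type*} [MeasurableSpace κ] [MeasurableSingletonClass κ]

/-- Sum over the cells of a shell of bounds of the form `min (μ A) √(μ A / n)`. -/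
lemma tsum_fiber_le {ψ : EuclideanSpace ℝ (Fin d) → ℕ × κ} (hψ : Measurable ψ) {F : Finset κ}
    (hF : ∀ x, (ψ x).2 ∈ F) {N : ℝ} (hN : (F.card : ℝ) ≤ N) (m : ℕ) {D : κ → ℝ≥0∞}
    (hD : ∀ z, D z ≤ ENNReal.ofReal
      (min (μ.real (ψ ⁻¹' {(m, z)})) √(μ.real (ψ ⁻¹' {(m, z)}) / n))) :
    ∑' z, D z ≤ ENNReal.ofReal (min (μ.real {x | (ψ x).1 = m})
      √(N * μ.real {x | (ψ x).1 = m} / n)) := by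
  have hzero : ∀ z ∉ F, D z = 0 := by
    intro z hz
    have : ψ ⁻¹' {(m, z)} = ∅ := by
      ext x
      simp only [Set.mem_preimage, Set.mem_singleton_iff, Set.mem_empty_iff_false, iff_false]
      exact fun h => hz (by have := hF x; rw [h] at this; exact this)
    simpa [this] using hD z
  rw [tsum_eq_sum hzero]
  have hsum : ∑ z ∈ F, μ.real (ψ ⁻¹' {(m, z)}) ≤ μ.real {x | (ψ x).1 = m} := by
    rw [← measureReal_biUnion_finset]
    · refine measureReal_mono ?_
      intro x hx
      simp only [Set.mem_iUnion, Set.mem_preimage, Set.mem_singleton_iff] at hx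
      obtain ⟨z, -, hz⟩ := hx
      simp [hz]
    · intro a _ b _ hab
      refine Set.disjoint_left.2 fun x hx hy => hab ?_
      simp only [Set.mem_preimage, Set.mem_singleton_iff] at hx hy
      exact (Prod.mk.inj (hx.symm.trans hy)).2
    · exact fun z _ => hψ (measurableSet_singleton _)
  refine (Finset.sum_le_sum fun z _ => hD z).trans ?_
  rw [← ENNReal.ofReal_sum_of_nonneg fun z _ => le_min measureReal_nonneg (Real.sqrt_nonneg _)]
  refine ENNReal.ofReal_le_ofReal (le_min ?_ ?_)
  · exact (Finset.sum_le_sum fun z _ => min_le_left _ _).trans hsum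
  -- Cauchy–Schwarz over the at most `N` cells of the shell.
  · refine (Finset.sum_le_sum fun z _ => min_le_right _ _).trans (Real.le_sqrt_of_sq_le ?_)
    refine sq_sum_le_card_mul_sum_sq.trans ?_
    have h1 : ∀ z ∈ F, √(μ.real (ψ ⁻¹' {(m, z)}) / n) ^ 2 = μ.real (ψ ⁻¹' {(m, z)}) / n :=
      fun z _ => Real.sq_sqrt (by positivity)
    rw [Finset.sum_congr rfl h1, ← Finset.sum_div, mul_div_assoc]
    have h0 : 0 ≤ N := (Nat.cast_nonneg _).trans hN
    gcongr

end EmpiricalDeviation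

/-! ### Geometric series and the sum over levels. -/

section GeometricSums

/-- The sum of the geometric series of ratio `2 ^ (-δ)`. -/
noncomputable def geomConst (δ : ℝ) : ℝ := (1 - (2 : ℝ) ^ (-δ))⁻¹

lemma two_rpow_neg_lt_one {δ : ℝ} (hδ : 0 < δ) : (2 : ℝ) ^ (-δ) < 1 :=
  Real.rpow_lt_one_of_one_lt_of_neg (by norm_num) (by linarith)

lemma geomConst_pos {δ : ℝ} (hδ : 0 < δ) : 0 < geomConst δ :=
  inv_pos.2 (by linarith [two_rpow_neg_lt_one hδ])

lemma tsum_two_rpow_neg {δ : ℝ} (hδ : 0 < δ) :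
    ∑' m : ℕ, ENNReal.ofReal ((2 : ℝ) ^ (-δ * m)) = ENNReal.ofReal (geomConst δ) := by
  have h1 := two_rpow_neg_lt_one hδ
  have h0 : (0 : ℝ) ≤ (2 : ℝ) ^ (-δ) := by positivity
  rw [geomConst, ← tsum_geometric_of_lt_one h0 h1, ENNReal.ofReal_tsum_of_nonneg
    (fun n => pow_nonneg h0 n) (summable_geometric_of_lt_one h0 h1)]
  refine tsum_congr fun m => ?_
  rw [Real.rpow_mul_natCast (by norm_num)]

lemma tsum_le_of_le_geometric {δ Y : ℝ} (hδ : 0 < δ) (hY : 0 ≤ Y) {f : ℕ → ℝ}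
    (hf : ∀ m : ℕ, f m ≤ (2 : ℝ) ^ (-δ * m) * Y) :
    ∑' m : ℕ, ENNReal.ofReal (f m) ≤ ENNReal.ofReal (geomConst δ * Y) := by
  rw [ENNReal.ofReal_mul' hY, ← tsum_two_rpow_neg hδ, ← ENNReal.tsum_mul_right]
  refine ENNReal.tsum_le_tsum fun m => ?_
  rw [← ENNReal.ofReal_mul' hY]
  exact ENNReal.ofReal_le_ofReal (hf m)

lemma tsum_eq_sum_range_add (f : ℕ → ℝ≥0∞) (N : ℕ) :
    ∑' m, f m = ∑ m ∈ Finset.range N, f m + ∑' m, f (m + N) :=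
  (ENNReal.summable.sum_add_tsum_nat_add' (f := f) (k := N)).symm

lemma two_rpow_le_two_rpow {x y : ℝ} (h : x ≤ y) : (2 : ℝ) ^ x ≤ (2 : ℝ) ^ y :=
  Real.rpow_le_rpow_of_exponent_le (by norm_num) h

/-- Split at `⌊M⌋₊`: each side of the peak is dominated by a geometric series. The peak may be
fractional or negative. -/
lemma tsum_two_rpow_neg_abs_le {δ : ℝ} (hδ : 0 < δ) (M : ℝ) :
    ∑' m : ℕ, ENNReal.ofReal ((2 : ℝ) ^ (-δ * |m - M|)) ≤
      ENNReal.ofReal (2 * geomConst δ) := by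
  set N := ⌊M⌋₊ with hN
  rw [tsum_eq_sum_range_add _ (N + 1), two_mul, ENNReal.ofReal_add (geomConst_pos hδ).le
    (geomConst_pos hδ).le]
  refine add_le_add ?_ ?_
  · rw [← Finset.sum_range_reflect, ← tsum_two_rpow_neg hδ]
    refine le_trans (Finset.sum_le_sum fun i hi => ?_) (ENNReal.sum_le_tsum (Finset.range (N + 1)))
    refine ENNReal.ofReal_le_ofReal (two_rpow_le_two_rpow ?_)
    have hi' : i ≤ N := Nat.lt_succ_iff.1 (Finset.mem_range.1 hi)
    have hcast : ((N + 1 - 1 - i : ℕ) : ℝ) = N - i := by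
      rw [Nat.add_sub_cancel, Nat.cast_sub hi']
    rw [hcast]
    have hle : (i : ℝ) ≤ |(N : ℝ) - i - M| := by
      rcases le_total 0 M with h | h
      · rw [abs_sub_comm]
        refine le_trans ?_ (le_abs_self _)
        have := Nat.floor_le h
        linarith
      · have : N = 0 := Nat.floor_of_nonpos h
        have hi0 : i = 0 := by omega
        simp [hi0]
    nlinarith
  · rw [← tsum_two_rpow_neg hδ]
    refine ENNReal.tsum_le_tsum fun i => ENNReal.ofReal_le_ofReal (two_rpow_le_two_rpow ?_)
    have hle : (i : ℝ) ≤ |((i + (N + 1) : ℕ) : ℝ) - M| := by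
      refine le_trans ?_ (le_abs_self _)
      have := Nat.lt_floor_add_one M
      push_cast
      linarith
    nlinarith

/-- A growing and a decaying geometric sequence: the sum of the minima is comparable to the
value at the crossing. -/
lemma tsum_min_geometric_le {δ a b X Y : ℝ} (hδ : 0 < δ) (ha : δ ≤ a) (hb : δ ≤ b)
    (hX : 0 < X) (hY : 0 < Y) :
    ∑' m : ℕ, ENNReal.ofReal (min ((2 : ℝ) ^ (-a * m) * X) ((2 : ℝ) ^ (b * m) * Y)) ≤
      ENNReal.ofReal (2 * geomConst δ * (X ^ (b / (a + b)) * Y ^ (a / (a + b)))) := by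
  have h2 : (0 : ℝ) < 2 := by norm_num
  obtain ⟨x, rfl⟩ : ∃ x : ℝ, (2 : ℝ) ^ x = X := ⟨_, Real.rpow_logb h2 (by norm_num) hX⟩
  obtain ⟨y, rfl⟩ : ∃ y : ℝ, (2 : ℝ) ^ y = Y := ⟨_, Real.rpow_logb h2 (by norm_num) hY⟩
  have hab : 0 < a + b := by linarith
  -- The real index where the two sequences cross; away from it the minimum decays at rate at least
  -- `δ`.
  set M := (x - y) / (a + b) with hM
  have hMab : M * (a + b) = x - y := div_mul_cancel₀ _ hab.ne'
  have hV : ((2 : ℝ) ^ x) ^ (b / (a + b)) * ((2 : ℝ) ^ y) ^ (a / (a + b)) =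
      (2 : ℝ) ^ (x - a * M) := by
    rw [← Real.rpow_mul h2.le, ← Real.rpow_mul h2.le, ← Real.rpow_add h2]
    congr 1
    rw [hM]
    field_simp
    ring
  rw [hV, ENNReal.ofReal_mul' (by positivity)]
  refine le_trans ?_ (mul_le_mul_left (tsum_two_rpow_neg_abs_le hδ M) _)
  rw [← ENNReal.tsum_mul_right]
  refine ENNReal.tsum_le_tsum fun m => ?_
  rw [← ENNReal.ofReal_mul' (by positivity)]
  refine ENNReal.ofReal_le_ofReal ?_
  simp only [← Real.rpow_add h2]
  rcases le_total M m with h | h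
  · refine (min_le_left _ _).trans (two_rpow_le_two_rpow ?_)
    rw [abs_of_nonneg (by linarith)]
    nlinarith
  · refine (min_le_right _ _).trans (two_rpow_le_two_rpow ?_)
    rw [abs_of_nonpos (by linarith)]
    nlinarith

/-- The critical case: a decaying geometric sequence cut at a constant level. -/
lemma tsum_min_const_le {δ a X Y t : ℝ} (hδ : 0 < δ) (ha : δ ≤ a) (hY : 0 ≤ Y) (ht : 1 ≤ t)
    (hXY : X ≤ t * Y) :
    ∑' m : ℕ, ENNReal.ofReal (min ((2 : ℝ) ^ (-a * m) * X) Y) ≤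
      ENNReal.ofReal ((geomConst δ + 1 + Real.logb 2 t / δ) * Y) := by
  have hlog : 0 ≤ Real.logb 2 t := Real.logb_nonneg (by norm_num) ht
  -- After `L` terms the geometric decay has absorbed the factor `t`; the first `L` terms, bounded
  -- by `Y` each, produce the logarithm.
  set L := ⌈Real.logb 2 t / δ⌉₊ with hL
  have hL1 : (L : ℝ) ≤ 1 + Real.logb 2 t / δ := by
    have := Nat.ceil_lt_add_one (div_nonneg hlog hδ.le)
    linarith
  have hL2 : Real.logb 2 t ≤ δ * L := by
    have := Nat.le_ceil (Real.logb 2 t / δ)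
    rw [div_le_iff₀ hδ] at this
    linarith
  have hG := geomConst_pos hδ
  rw [tsum_eq_sum_range_add _ L]
  calc _ ≤ ∑ m ∈ Finset.range L, ENNReal.ofReal Y + ENNReal.ofReal (geomConst δ * Y) := by
        refine add_le_add (Finset.sum_le_sum fun m _ =>
          ENNReal.ofReal_le_ofReal (min_le_right _ _)) ?_
        refine tsum_le_of_le_geometric hδ hY fun m => (min_le_left _ _).trans ?_
        have h1 : (2 : ℝ) ^ (-a * ((m + L : ℕ) : ℝ)) ≤ (2 : ℝ) ^ (-δ * m) * t⁻¹ := by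
          have ht2 : t⁻¹ = (2 : ℝ) ^ (-Real.logb 2 t) := by
            rw [Real.rpow_neg (by norm_num), Real.rpow_logb (by norm_num) (by norm_num)
              (by linarith)]
          rw [ht2, ← Real.rpow_add (by norm_num)]
          refine two_rpow_le_two_rpow ?_
          push_cast
          nlinarith [Nat.cast_nonneg (α := ℝ) m, Nat.cast_nonneg (α := ℝ) L]
        calc _ ≤ (2 : ℝ) ^ (-a * ((m + L : ℕ) : ℝ)) * (t * Y) := by gcongr
          _ ≤ ((2 : ℝ) ^ (-δ * m) * t⁻¹) * (t * Y) := by gcongr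
          _ = _ := by field_simp
    _ = ENNReal.ofReal (L * Y) + ENNReal.ofReal (geomConst δ * Y) := by
        rw [Finset.sum_const, Finset.card_range, nsmul_eq_mul,
          ENNReal.ofReal_mul (p := (L : ℝ)) (Nat.cast_nonneg L), ENNReal.ofReal_natCast]
    _ ≤ _ := by
        rw [← ENNReal.ofReal_add (by positivity) (by positivity), ← add_mul]
        exact ENNReal.ofReal_le_ofReal (mul_le_mul_of_nonneg_right (by linarith) hY)

/-- The sum over the levels `l` of the error in a shell of mass `ε`, where level `l` has
`(A * 2 ^ l) ^ κ` cells. -/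
noncomputable def levelSum (p A κ N ε : ℝ) : ℝ≥0∞ :=
  ∑' l : ℕ, ENNReal.ofReal ((2 : ℝ) ^ (-p * l) * min ε √((A * 2 ^ l) ^ κ * ε / N))

variable {p A κ N ε δ : ℝ}

/-- Used to raise `κ` from the critical value `k = 2 p` to a nearby noncritical real, which is why
`κ` is not an integer. -/
lemma levelSum_mono {κ' : ℝ} (hA : 1 ≤ A) (hN : 0 < N) (hε : 0 ≤ ε)
    (h : κ ≤ κ') :
    levelSum p A κ N ε ≤ levelSum p A κ' N ε := by
  refine ENNReal.tsum_le_tsum fun l => ENNReal.ofReal_le_ofReal ?_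
  have : (1 : ℝ) ≤ A * 2 ^ l := one_le_mul_of_one_le_of_one_le hA (one_le_pow₀ (by norm_num))
  gcongr

lemma level_term_eq (hA : 0 < A) (hε : 0 ≤ ε) (l : ℕ) :
    (2 : ℝ) ^ (-p * l) * min ε √((A * 2 ^ l) ^ κ * ε / N) =
      min ((2 : ℝ) ^ (-p * l) * ε) ((2 : ℝ) ^ ((κ / 2 - p) * l) * (A ^ (κ / 2) * √(ε / N))) := by
  rw [mul_min_of_nonneg _ _ (by positivity)]
  congr 1
  rw [mul_div_assoc, Real.sqrt_mul (by positivity), Real.mul_rpow hA.le (by positivity),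
    Real.sqrt_mul (by positivity), Real.sqrt_eq_rpow (A ^ κ), ← Real.rpow_mul hA.le,
    Real.sqrt_eq_rpow (((2 : ℝ) ^ l) ^ κ), ← Real.rpow_mul (by positivity),
    ← Real.rpow_natCast_mul (by norm_num)]
  have : (2 : ℝ) ^ ((κ / 2 - p) * l) = (2 : ℝ) ^ (-p * l) * (2 : ℝ) ^ (l * (κ * (1 / 2))) := by
    rw [← Real.rpow_add (by norm_num)]
    congr 1
    ring
  rw [this]
  ring_nf

/-- Puts the fluctuation in the form `ε (N ε) ^ (-r)` common to all regimes, here with `r = 1 / 2`.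
-/
lemma sqrt_div_eq (hN : 0 < N) (hε : 0 < ε) : √(ε / N) = ε * (N * ε) ^ (-(1 / 2) : ℝ) := by
  rw [Real.rpow_neg (by positivity), ← Real.sqrt_eq_rpow, Real.sqrt_mul hN.le, Real.sqrt_div hε.le]
  have h1 := Real.mul_self_sqrt hε.le
  have h2 : 0 < √ε := Real.sqrt_pos.2 hε
  have h3 : 0 < √N := Real.sqrt_pos.2 hN
  field_simp
  linarith

lemma levelSum_le_trivial (hδ : 0 < δ) (hp : δ ≤ p) (hε : 0 ≤ ε) :
    levelSum p A κ N ε ≤ ENNReal.ofReal (geomConst δ * ε) := by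
  refine tsum_le_of_le_geometric hδ hε fun l => ?_
  refine mul_le_mul (two_rpow_le_two_rpow ?_) (min_le_left _ _)
    (le_min hε (Real.sqrt_nonneg _)) (by positivity)
  nlinarith [Nat.cast_nonneg (α := ℝ) l]

/-- Below the critical dimension the fluctuations decrease with the level, so the coarsest level
dominates. -/
lemma levelSum_le_of_lt (hA : 1 ≤ A) (hN : 0 < N) (hδ : 0 < δ) (hκ : δ ≤ p - κ / 2) (hε : 0 < ε) :
    levelSum p A κ N ε ≤
      ENNReal.ofReal (geomConst δ * (A ^ p * (ε * (N * ε) ^ (-(1 / 2) : ℝ)))) := by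
  refine tsum_le_of_le_geometric hδ (by positivity) fun l => ?_
  rw [level_term_eq (by linarith) hε.le, ← sqrt_div_eq hN hε]
  refine (min_le_right _ _).trans ?_
  have h1 : (2 : ℝ) ^ ((κ / 2 - p) * l) ≤ (2 : ℝ) ^ (-δ * l) :=
    two_rpow_le_two_rpow (by nlinarith [Nat.cast_nonneg (α := ℝ) l])
  have h2 : A ^ (κ / 2) ≤ A ^ p := Real.rpow_le_rpow_of_exponent_le hA (by linarith)
  gcongr

/-- The level where trivial and fluctuation bounds cross dominates. Interpolating there raises `A ^
(κ / 2)` to the power `p / (κ / 2)`, which leaves `A ^ p`, free of the dimension. -/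
lemma levelSum_le_of_gt (hA : 1 ≤ A) (hN : 0 < N) (hδ : 0 < δ) (hp : δ ≤ p) (hκ : δ ≤ κ / 2 - p)
    (hε : 0 < ε) :
    levelSum p A κ N ε ≤
      ENNReal.ofReal (2 * geomConst δ * (A ^ p * (ε * (N * ε) ^ (-(p / κ))))) := by
  have hA0 : 0 < A := by linarith
  have hκ0 : 0 < κ := by linarith
  rw [levelSum]
  simp only [level_term_eq hA0 hε.le]
  refine (tsum_min_geometric_le hδ hp hκ hε (by positivity)).trans (le_of_eq ?_)
  congr 2
  have e1 : p + (κ / 2 - p) = κ / 2 := by ring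
  rw [e1, sqrt_div_eq hN hε, Real.mul_rpow (by positivity) (by positivity),
    Real.mul_rpow hε.le (by positivity), ← Real.rpow_mul hA0.le, ← Real.rpow_mul (by positivity)]
  have e2 : κ / 2 * (p / (κ / 2)) = p := by field_simp
  have e3 : -(1 / 2) * (p / (κ / 2)) = -(p / κ) := by field_simp
  have e4 : ε ^ ((κ / 2 - p) / (κ / 2)) * ε ^ (p / (κ / 2)) = ε := by
    rw [← Real.rpow_add hε]
    have : (κ / 2 - p) / (κ / 2) + p / (κ / 2) = 1 := by field_simp; ring
    rw [this, Real.rpow_one]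
  rw [e2, e3]
  linear_combination A ^ p * (N * ε) ^ (-(p / κ)) * e4

/-- At the critical dimension the fluctuation bound is the same at all levels; it is used on about
`log √N` of them before the trivial bound takes over. -/
lemma levelSum_le_of_eq (hA : 1 ≤ A) (hN : 1 ≤ N) (hδ : 0 < δ) (hp : δ ≤ p) (hκ : κ = 2 * p)
    (hε : 0 < ε) (hε1 : ε ≤ 1) :
    levelSum p A κ N ε ≤ ENNReal.ofReal ((geomConst δ + 1 + Real.logb 2 √N / δ) *
      (A ^ p * (ε * (N * ε) ^ (-(1 / 2) : ℝ)))) := by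
  have hA0 : 0 < A := by linarith
  have hN0 : 0 < N := by linarith
  rw [levelSum]
  simp only [level_term_eq hA0 hε.le]
  have e1 : κ / 2 = p := by linarith
  rw [← sqrt_div_eq hN0 hε, e1]
  simp only [sub_self, zero_mul, Real.rpow_zero, one_mul]
  refine tsum_min_const_le hδ hp (by positivity) (Real.one_le_sqrt.2 hN) ?_
  have h1 : 1 ≤ A ^ p := Real.one_le_rpow hA (by linarith)
  have h2 : ε ≤ √ε := by
    rw [Real.le_sqrt hε.le hε.le]
    nlinarith
  calc ε ≤ √ε := h2
    _ = √N * (1 * √(ε / N)) := by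
        rw [one_mul, ← Real.sqrt_mul hN0.le]
        congr 1
        field_simp
    _ ≤ √N * (A ^ p * √(ε / N)) := by gcongr

end GeometricSums

/-! ### The sum over shells, uniformly in the dimension. -/

section RateSum

/-- The sum over all shells `m` and levels `l`, for masses `2 ^ (-q m)` of the shells. -/
noncomputable def rateSum (p q A κ N : ℝ) : ℝ≥0∞ :=
  ∑' m : ℕ, ENNReal.ofReal ((2 : ℝ) ^ (p * m)) * levelSum p A κ N ((2 : ℝ) ^ (-q * m))

variable {p q A κ N δ r B : ℝ}

/-- With shell masses `2 ^ (-q m)` the fluctuation bound has exponent `p - q + q r` in `m`. Its sign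
decides whether the inner shells, the crossing shell, or a logarithmic number of shells dominate. -/
lemma rateSum_le_tsum (hB : 0 ≤ B) (hN : 0 < N)
    (h0 : ∀ m : ℕ, levelSum p A κ N ((2 : ℝ) ^ (-q * m)) ≤
      ENNReal.ofReal (B * (2 : ℝ) ^ (-q * m)))
    (h1 : ∀ m : ℕ, levelSum p A κ N ((2 : ℝ) ^ (-q * m)) ≤
      ENNReal.ofReal (B * ((2 : ℝ) ^ (-q * m) * (N * (2 : ℝ) ^ (-q * m)) ^ (-r)))) :
    rateSum p q A κ N ≤ ENNReal.ofReal B * ∑' m : ℕ, ENNReal.ofReal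
      (min ((2 : ℝ) ^ (-(q - p) * m) * 1) ((2 : ℝ) ^ ((p - q + q * r) * m) * N ^ (-r))) := by
  rw [rateSum, ← ENNReal.tsum_mul_left]
  refine ENNReal.tsum_le_tsum fun m => ?_
  have hmin := le_min (h0 m) (h1 m)
  rw [← ENNReal.ofReal_min, ← mul_min_of_nonneg _ _ hB] at hmin
  refine (mul_le_mul_right hmin _).trans (le_of_eq ?_)
  rw [← ENNReal.ofReal_mul (by positivity), ← ENNReal.ofReal_mul hB]
  congr 1
  rw [mul_left_comm, mul_min_of_nonneg _ _ (by positivity), ← Real.rpow_add (by norm_num),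
    Real.mul_rpow hN.le (by positivity), ← Real.rpow_mul (by norm_num)]
  congr 2
  · rw [mul_one]
    congr 1
    ring
  · have : (2 : ℝ) ^ ((p - q + q * r) * m) =
        (2 : ℝ) ^ (p * m) * ((2 : ℝ) ^ (-q * m) * (2 : ℝ) ^ (-q * m * -r)) := by
      rw [← Real.rpow_add (by norm_num), ← Real.rpow_add (by norm_num)]
      congr 1
      ring
    rw [this]
    ring

lemma tsum_shell_le_of_neg (hN : 0 < N) (hδ : 0 < δ) (hb : p - q + q * r ≤ -δ) :
    ∑' m : ℕ, ENNReal.ofReal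
      (min ((2 : ℝ) ^ (-(q - p) * m) * 1) ((2 : ℝ) ^ ((p - q + q * r) * m) * N ^ (-r))) ≤
      ENNReal.ofReal (geomConst δ * N ^ (-r)) := by
  refine tsum_le_of_le_geometric hδ (by positivity) fun m => (min_le_right _ _).trans ?_
  have : (2 : ℝ) ^ ((p - q + q * r) * m) ≤ (2 : ℝ) ^ (-δ * m) :=
    two_rpow_le_two_rpow (by nlinarith [Nat.cast_nonneg (α := ℝ) m])
  gcongr

/-- The rates `q - p` and `p - q + q r` add up to `q r`, so at the crossing `N ^ (-r)` is raised to
`(q - p) / (q r)` and `r` drops out. -/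
lemma tsum_shell_le_of_pos (hN : 0 < N) (hδ : 0 < δ) (hq : 0 < q) (hr : 0 < r) (ha : δ ≤ q - p)
    (hb : δ ≤ p - q + q * r) :
    ∑' m : ℕ, ENNReal.ofReal
      (min ((2 : ℝ) ^ (-(q - p) * m) * 1) ((2 : ℝ) ^ ((p - q + q * r) * m) * N ^ (-r))) ≤
      ENNReal.ofReal (2 * geomConst δ * N ^ (-(1 - p / q))) := by
  refine (tsum_min_geometric_le hδ ha hb one_pos (by positivity)).trans (le_of_eq ?_)
  rw [Real.one_rpow, one_mul, ← Real.rpow_mul hN.le]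
  congr 3
  have : q - p + (p - q + q * r) = q * r := by ring
  rw [this]
  field_simp

lemma tsum_shell_le_of_eq (hN : 1 ≤ N) (hδ : 0 < δ) (hr : 0 ≤ r) (ha : δ ≤ q - p)
    (hb : p - q + q * r = 0) :
    ∑' m : ℕ, ENNReal.ofReal
      (min ((2 : ℝ) ^ (-(q - p) * m) * 1) ((2 : ℝ) ^ ((p - q + q * r) * m) * N ^ (-r))) ≤
      ENNReal.ofReal ((geomConst δ + 1 + Real.logb 2 (N ^ r) / δ) * N ^ (-r)) := by
  have hN0 : 0 < N := by linarith
  rw [hb]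
  simp only [zero_mul, Real.rpow_zero, one_mul]
  refine tsum_min_const_le hδ ha (by positivity) (Real.one_le_rpow hN hr) ?_
  rw [← Real.rpow_add hN0]
  simp

/-- A convergent sequence is bounded; vanishing `u k` do no harm, since their inverse is `0`. -/
lemma exists_pos_le_abs {u : ℕ → ℝ} {L : ℝ}
    (h : Filter.Tendsto (fun k => |u k|⁻¹) Filter.atTop (nhds L)) :
    ∃ δ : ℝ, 0 < δ ∧ ∀ k, u k ≠ 0 → δ ≤ |u k| := by
  obtain ⟨K, hK⟩ := h.bddAbove_range
  refine ⟨(max K 1)⁻¹, by positivity, fun k hk => ?_⟩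
  have h1 : |u k|⁻¹ ≤ max K 1 := (hK ⟨k, rfl⟩).trans (le_max_left _ _)
  exact (inv_le_comm₀ (abs_pos.2 hk) (by positivity)).1 h1

/-- The values tend to infinity, so only finitely many are near zero. This makes the geometric
constants independent of `k`. -/
lemma exists_gap_dim (p : ℝ) :
    ∃ δ : ℝ, 0 < δ ∧ ∀ k : ℕ, (k : ℝ) / 2 - p ≠ 0 → δ ≤ |(k : ℝ) / 2 - p| := by
  refine exists_pos_le_abs (u := fun k : ℕ => (k : ℝ) / 2 - p) (L := 0) ?_
  refine Filter.Tendsto.inv_tendsto_atTop (Filter.tendsto_abs_atTop_atTop.comp ?_)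
  exact Filter.tendsto_atTop_add_const_right _ _
    (tendsto_natCast_atTop_atTop.atTop_div_const (by norm_num))

/-- The values converge to `p - q`, which is nonzero. -/
lemma exists_gap_moment {p q : ℝ} (hpq : p < q) :
    ∃ δ : ℝ, 0 < δ ∧ ∀ k : ℕ, p - q + q * (p / max (2 * p) (k : ℝ)) ≠ 0 →
      δ ≤ |p - q + q * (p / max (2 * p) (k : ℝ))| := by
  refine exists_pos_le_abs (u := fun k : ℕ => p - q + q * (p / max (2 * p) (k : ℝ)))
    (L := |p - q + q * 0|⁻¹) ?_
  refine Filter.Tendsto.inv₀ (Filter.Tendsto.abs ?_) (by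
    rw [mul_zero, add_zero]
    exact abs_ne_zero.2 (by linarith))
  refine tendsto_const_nhds.add (tendsto_const_nhds.mul (tendsto_const_nhds.div_atTop ?_))
  exact Filter.tendsto_atTop_mono (fun k => le_max_right _ _) tendsto_natCast_atTop_atTop

lemma zeta_nonneg_and_le (p q : ℝ) (k : ℕ) : 0 ≤ zeta p q k ∧ zeta p q k ≤ 2 := by
  unfold zeta
  split_ifs <;> norm_num

lemma half_le_log {n : ℕ} (hn : 2 ≤ n) : 1 / 2 ≤ Real.log n := by
  have h1 : Real.log 2 ≤ Real.log n :=
    Real.log_le_log (by norm_num) (by exact_mod_cast hn)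
  linarith [Real.log_two_gt_d9]

/-- Lets the logarithmic factor be inserted at the cost of a factor `4` where it is not needed. For
`n = 1` it is `0 ^ 0 = 1`. -/
lemma quarter_le_log_rpow {p q : ℝ} {k n : ℕ} (hn : 2 ≤ n ∨ (n = 1 ∧ zeta p q k = 0)) :
    1 / 4 ≤ Real.log n ^ zeta p q k := by
  rcases hn with hn | ⟨-, h⟩
  · obtain ⟨h0, h2⟩ := zeta_nonneg_and_le p q k
    calc (1 / 4 : ℝ) = (1 / 2 : ℝ) ^ (2 : ℝ) := by norm_num
      _ ≤ (1 / 2 : ℝ) ^ zeta p q k :=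
          Real.rpow_le_rpow_of_exponent_ge (by norm_num) (by norm_num) h2
      _ ≤ Real.log n ^ zeta p q k := Real.rpow_le_rpow (by norm_num) (half_le_log hn) h0
  · rw [h, Real.rpow_zero]
    norm_num

lemma const_add_logb_le {G δ t : ℝ} (hG : 0 ≤ G) (hδ : 0 < δ) {n : ℕ} (hn : 2 ≤ n)
    (ht : Real.log t ≤ 1 / 2 * Real.log n) :
    G + 1 + Real.logb 2 t / δ ≤ (2 * G + 2 + δ⁻¹) * Real.log n := by
  have h1 := half_le_log hn
  have h2 : Real.logb 2 t ≤ Real.log n := by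
    rw [Real.logb, div_le_iff₀ (Real.log_pos (by norm_num))]
    nlinarith [Real.log_two_gt_d9]
  have h3 : Real.logb 2 t / δ ≤ δ⁻¹ * Real.log n := by
    rw [div_eq_inv_mul]
    gcongr
  nlinarith

/-- The double sum is bounded by the rate, with a constant that does not depend on `k`. -/
theorem exists_rateSum_le (p q : ℝ) (hp : 1 ≤ p) (hpq : p < q) (A : ℝ) (hA : 1 ≤ A) :
    ∃ C : ℝ, 0 < C ∧ ∀ k n : ℕ, 1 ≤ k → (2 ≤ n ∨ (n = 1 ∧ zeta p q k = 0)) →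
      rateSum p q A k n ≤ ENNReal.ofReal
        (C * ((n : ℝ) ^ (-(min (p / max (2 * p) (k : ℝ)) (1 - p / q))) *
          Real.log n ^ zeta p q k)) := by
  obtain ⟨δ₁, hδ₁, hgap₁⟩ := exists_gap_dim p
  obtain ⟨δ₂, hδ₂, hgap₂⟩ := exists_gap_moment hpq
  have hp0 : 0 < p := by linarith
  have hq0 : 0 < q := by linarith
  have hqp : 0 < q - p := by linarith
  -- For `q < 2 p` the interval from `2 p` to `p q / (q - p)` is nonempty. Its midpoint is a
  -- supercritical dimension for which the moment still limits the rate.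
  obtain ⟨κ₀, δ₃, hδ₃, hκ₀⟩ : ∃ κ₀ δ₃ : ℝ, 0 < δ₃ ∧
      (q < 2 * p → δ₃ ≤ κ₀ / 2 - p ∧ δ₃ ≤ p - q + q * (p / κ₀)) := by
    by_cases h : q < 2 * p
    · set κ₀ := (2 * p + p * q / (q - p)) / 2 with hκ
      have h1 : 2 * p < p * q / (q - p) := by
        rw [lt_div_iff₀ hqp]
        nlinarith
      have h2 : 2 * p < κ₀ := by linarith
      have h3 : κ₀ * (q - p) < p * q := by
        rw [← lt_div_iff₀ hqp]
        linarith
      have h4 : 0 < p - q + q * (p / κ₀) := by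
        have : q - p < p * q / κ₀ := by
          rw [lt_div_iff₀ (by linarith)]
          linarith
        have h5 : q * (p / κ₀) = p * q / κ₀ := by ring
        linarith
      exact ⟨κ₀, min (κ₀ / 2 - p) (p - q + q * (p / κ₀)), lt_min (by linarith) h4,
        fun _ => ⟨min_le_left _ _, min_le_right _ _⟩⟩
    · exact ⟨0, 1, one_pos, fun h' => absurd h' h⟩
  obtain ⟨δ, hδ, d1, d2, d3, d4, d5⟩ : ∃ δ : ℝ, 0 < δ ∧ δ ≤ δ₁ ∧ δ ≤ δ₂ ∧ δ ≤ δ₃ ∧ δ ≤ p ∧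
      δ ≤ q - p := by
    refine ⟨min δ₁ (min δ₂ (min δ₃ (min p (q - p)))), by positivity, ?_, ?_, ?_, ?_, ?_⟩ <;> simp
  set G := geomConst δ with hG
  have hGpos : 0 < G := geomConst_pos hδ
  have hAp : 1 ≤ A ^ p := Real.one_le_rpow hA hp0.le
  set H := 2 * G + 2 + δ⁻¹ with hH
  have hHpos : 0 < H := by positivity
  set B := H * A ^ p with hB
  have hBpos : 0 < B := by positivity
  have hGH : 2 * G ≤ H := by
    have : 0 < δ⁻¹ := by positivity
    linarith
  have hGB : G ≤ B := by nlinarith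
  have hGB2 : 2 * G * A ^ p ≤ B := by
    rw [hB]
    gcongr
  refine ⟨4 * (B * H), by positivity, fun k n hk hn => ?_⟩
  have hn1 : 1 ≤ n := by omega
  have hN : (1 : ℝ) ≤ n := by exact_mod_cast hn1
  have hN0 : (0 : ℝ) < n := by linarith
  set r := p / max (2 * p) (k : ℝ) with hr
  have hrpos : 0 < r := div_pos hp0 (lt_max_of_lt_left (by linarith))
  have hr2 : r ≤ 1 / 2 := by
    rw [hr, div_le_iff₀ (lt_max_of_lt_left (by linarith))]
    linarith [le_max_left (2 * p) (k : ℝ)]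
  have hq4 := quarter_le_log_rpow (p := p) (q := q) (k := k) hn
  set ε : ℕ → ℝ := fun m => (2 : ℝ) ^ (-q * m) with hε
  have hε0 : ∀ m, 0 < ε m := fun m => by positivity
  have hε1 : ∀ m, ε m ≤ 1 := fun m =>
    Real.rpow_le_one_of_one_le_of_nonpos (by norm_num)
      (by nlinarith [Nat.cast_nonneg (α := ℝ) m])
  have htriv : ∀ (κ : ℝ) m, levelSum p A κ n (ε m) ≤ ENNReal.ofReal (B * ε m) := fun κ m =>
    (levelSum_le_trivial hδ d4 (hε0 m).le).trans (ENNReal.ofReal_le_ofReal (by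
      have := hε0 m
      gcongr))
  have hgt : ∀ κ : ℝ, δ ≤ κ / 2 - p → ∀ m, levelSum p A κ n (ε m) ≤
      ENNReal.ofReal (B * (ε m * (n * ε m) ^ (-(p / κ)))) := fun κ hκ m =>
    (levelSum_le_of_gt hA hN0 hδ d4 hκ (hε0 m)).trans (ENNReal.ofReal_le_ofReal (by
      have := hε0 m
      rw [← mul_assoc]
      gcongr))
  have hne : (k : ℝ) ≠ 2 * p → ∀ m, levelSum p A k n (ε m) ≤
      ENNReal.ofReal (B * (ε m * (n * ε m) ^ (-r))) := by
    intro hk2 m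
    have hgap := d1.trans (hgap₁ k (fun h => hk2 (by linarith)))
    rcases lt_or_gt_of_ne hk2 with h | h
    · rw [abs_of_neg (by linarith)] at hgap
      have hr' : r = 1 / 2 := by
        rw [hr, max_eq_left h.le]
        field_simp
      rw [hr']
      refine (levelSum_le_of_lt hA hN0 hδ (by linarith) (hε0 m)).trans
        (ENNReal.ofReal_le_ofReal ?_)
      have := hε0 m
      rw [← mul_assoc]
      have hG' : geomConst δ * A ^ p ≤ B := by
        rw [hB]
        gcongr
        linarith
      gcongr
    · rw [abs_of_pos (by linarith)] at hgap
      have hr' : r = p / k := by rw [hr, max_eq_right h.le]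
      rw [hr']
      exact hgt k hgap m
  have heq : (k : ℝ) = 2 * p → 2 ≤ n → ∀ m, levelSum p A k n (ε m) ≤
      ENNReal.ofReal (B * Real.log n * (ε m * (n * ε m) ^ (-r))) := by
    intro hk2 hn2 m
    have hr' : r = 1 / 2 := by
      rw [hr, hk2, max_self]
      field_simp
    rw [hr']
    refine (levelSum_le_of_eq hA hN hδ d4 hk2 (hε0 m) (hε1 m)).trans
      (ENNReal.ofReal_le_ofReal ?_)
    have h1 := const_add_logb_le hGpos.le hδ (t := √n) hn2 (by
      rw [Real.log_sqrt hN0.le]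
      linarith)
    have := hε0 m
    calc _ ≤ H * Real.log n * (A ^ p * (ε m * (n * ε m) ^ (-(1 / 2) : ℝ))) := by gcongr
      _ = _ := by rw [hB]; ring
  -- `rateSum_le_tsum` needs one prefactor for both bounds; `1 ≤ 2 * log n` lets the trivial one
  -- carry the logarithm too.
  have htriv_log : 2 ≤ n → ∀ m, levelSum p A k n (ε m) ≤
      ENNReal.ofReal (2 * B * Real.log n * ε m) := fun hn2 m =>
    (htriv k m).trans (ENNReal.ofReal_le_ofReal (by
      have := half_le_log hn2
      have h0 := hε0 m
      gcongr
      nlinarith))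
  have heq' : (k : ℝ) = 2 * p → 2 ≤ n → ∀ m, levelSum p A k n (ε m) ≤
      ENNReal.ofReal (2 * B * Real.log n * (ε m * (n * ε m) ^ (-r))) := fun h hn2 m =>
    (heq h hn2 m).trans (ENNReal.ofReal_le_ofReal (by
      have := half_le_log hn2
      have h0 := hε0 m
      gcongr
      linarith))
  -- The sign of the shell exponent tells which of the two rates is the minimum.
  have hb_eq : p - q + q * r = q * (r - (1 - p / q)) := by
    field_simp
    ring
  rcases lt_trichotomy (p - q + q * r) 0 with hb | hb | hb
  · have hmin : min r (1 - p / q) = r := by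
      refine min_eq_left ?_
      rw [hb_eq] at hb
      nlinarith
    have hgap := d2.trans (hgap₂ k hb.ne)
    rw [abs_of_neg hb] at hgap
    have hsum := tsum_shell_le_of_neg (N := (n : ℝ)) (p := p) (q := q) (r := r) hN0 hδ
      (by linarith)
    rw [hmin]
    have hnr : 0 < (n : ℝ) ^ (-r) := by positivity
    by_cases hk2 : (k : ℝ) = 2 * p
    · have hr' : r = 1 / 2 := by
        rw [hr, hk2, max_self]
        field_simp
      have hq2 : 2 * p < q := by rw [hr'] at hb; linarith
      have hz : zeta p q k = 1 := by
        rw [zeta, if_neg (by rintro ⟨-, h⟩; linarith), if_pos]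
        exact Or.inr (Or.inr ⟨by linarith, hk2⟩)
      have hn2 : 2 ≤ n := by
        rcases hn with h | ⟨-, h⟩
        · exact h
        · rw [hz] at h; norm_num at h
      have hlog := half_le_log hn2
      refine (rateSum_le_tsum (B := 2 * B * Real.log n) (r := r) (by positivity) hN0
        (htriv_log hn2) (heq' hk2 hn2)).trans ?_
      refine (mul_le_mul_right hsum _).trans ?_
      rw [← ENNReal.ofReal_mul (by positivity)]
      refine ENNReal.ofReal_le_ofReal ?_
      rw [hz, Real.rpow_one]
      calc 2 * B * Real.log n * (G * (n : ℝ) ^ (-r))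
          = (2 * G) * (B * Real.log n * (n : ℝ) ^ (-r)) := by ring
        _ ≤ (4 * H) * (B * Real.log n * (n : ℝ) ^ (-r)) := by gcongr <;> linarith
        _ = _ := by ring
    · refine (rateSum_le_tsum hBpos.le hN0 (htriv k) (hne hk2)).trans ?_
      refine (mul_le_mul_right hsum _).trans ?_
      rw [← ENNReal.ofReal_mul (by positivity)]
      refine ENNReal.ofReal_le_ofReal ?_
      calc B * (G * (n : ℝ) ^ (-r)) ≤ 4 * (B * H) * ((n : ℝ) ^ (-r) * (1 / 4)) := by
            have : G ≤ H := by linarith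
            have : B * (G * (n : ℝ) ^ (-r)) ≤ B * (H * (n : ℝ) ^ (-r)) := by gcongr
            linarith
        _ ≤ _ := by gcongr
  · have hmin : min r (1 - p / q) = r := by
      refine min_eq_left ?_
      rw [hb_eq] at hb
      nlinarith
    have hsum := tsum_shell_le_of_eq (N := (n : ℝ)) hN hδ hrpos.le d5 hb
    have hz1 : zeta p q k = if (k : ℝ) = 2 * p then 2 else 1 := by
      by_cases hk2 : (k : ℝ) = 2 * p
      · have hr' : r = 1 / 2 := by
          rw [hr, hk2, max_self]
          field_simp
        rw [hr'] at hb
        rw [if_pos hk2, zeta, if_pos ⟨by linarith, by linarith⟩]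
      · rw [if_neg hk2, zeta, if_neg (by rintro ⟨h1, h2⟩; exact hk2 (h1.trans h2)), if_pos]
        rcases lt_or_gt_of_ne hk2 with h | h
        · have hr' : r = 1 / 2 := by
            rw [hr, max_eq_left h.le]
            field_simp
          rw [hr'] at hb
          exact Or.inr (Or.inl ⟨h, by linarith⟩)
        · have hr' : r = p / k := by rw [hr, max_eq_right h.le]
          rw [hr'] at hb
          refine Or.inl ⟨hk2, by linarith, ?_⟩
          have hkp : (0 : ℝ) < k - p := by linarith
          have hk0 : (0 : ℝ) < k := by linarith
          rw [eq_div_iff hkp.ne']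
          field_simp at hb
          linarith
    have hn2 : 2 ≤ n := by
      rcases hn with h | ⟨-, h⟩
      · exact h
      · rw [hz1] at h; split_ifs at h <;> norm_num at h
    have hlog := half_le_log hn2
    have hfac := const_add_logb_le hGpos.le hδ (t := (n : ℝ) ^ r) hn2 (by
      rw [Real.log_rpow hN0]
      gcongr)
    rw [hmin]
    have hnr : 0 < (n : ℝ) ^ (-r) := by positivity
    by_cases hk2 : (k : ℝ) = 2 * p
    · refine (rateSum_le_tsum (B := 2 * B * Real.log n) (r := r) (by positivity) hN0
        (htriv_log hn2) (heq' hk2 hn2)).trans ?_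
      refine (mul_le_mul_right hsum _).trans ?_
      rw [← ENNReal.ofReal_mul (by positivity)]
      refine ENNReal.ofReal_le_ofReal ?_
      rw [hz1, if_pos hk2, Real.rpow_two]
      calc _ ≤ 2 * B * Real.log n * (H * Real.log n * (n : ℝ) ^ (-r)) := by gcongr
        _ = 2 * (B * H * (n : ℝ) ^ (-r) * Real.log n ^ 2) := by ring
        _ ≤ 4 * (B * H * (n : ℝ) ^ (-r) * Real.log n ^ 2) := by gcongr; norm_num
        _ = _ := by ring
    · refine (rateSum_le_tsum hBpos.le hN0 (htriv k) (hne hk2)).trans ?_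
      refine (mul_le_mul_right hsum _).trans ?_
      rw [← ENNReal.ofReal_mul (by positivity)]
      refine ENNReal.ofReal_le_ofReal ?_
      rw [hz1, if_neg hk2, Real.rpow_one]
      calc _ ≤ B * (H * Real.log n * (n : ℝ) ^ (-r)) := by gcongr
        _ = 1 * (B * H * (n : ℝ) ^ (-r) * Real.log n) := by ring
        _ ≤ 4 * (B * H * (n : ℝ) ^ (-r) * Real.log n) := by gcongr; norm_num
        _ = _ := by ring
  · have hmin : min r (1 - p / q) = 1 - p / q := by
      refine min_eq_right ?_
      rw [hb_eq] at hb
      have := (mul_pos_iff_of_pos_left hq0).1 hb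
      linarith
    have hgap := d2.trans (hgap₂ k hb.ne')
    rw [abs_of_pos hb] at hgap
    rw [hmin]
    have hfin : rateSum p q A k n ≤ ENNReal.ofReal B *
        ENNReal.ofReal (2 * geomConst δ * (n : ℝ) ^ (-(1 - p / q))) := by
      -- At `k = 2 p` with `q < 2 p` the level sum would lose a logarithm that `ζ = 0` does not
      -- allow; enlarging the dimension to `κ₀` avoids it without changing the rate `1 - p / q`.
      by_cases hk2 : (k : ℝ) = 2 * p
      · have hr' : r = 1 / 2 := by
          rw [hr, hk2, max_self]
          field_simp
        have hq2 : q < 2 * p := by rw [hr'] at hb; linarith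
        obtain ⟨h1, h2⟩ := hκ₀ hq2
        have hκpos : 0 < κ₀ := by linarith
        refine le_trans ?_ (mul_le_mul_right (tsum_shell_le_of_pos (r := p / κ₀) hN0 hδ hq0
          (by positivity) d5 (d3.trans h2)) _)
        refine le_trans ?_ (rateSum_le_tsum hBpos.le hN0 (htriv κ₀) (hgt κ₀ (d3.trans h1)))
        refine ENNReal.tsum_le_tsum fun m => mul_le_mul_right ?_ _
        exact levelSum_mono hA hN0 (hε0 m).le (by linarith)
      · refine le_trans ?_ (mul_le_mul_right (tsum_shell_le_of_pos hN0 hδ hq0 hrpos d5 hgap) _)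
        exact rateSum_le_tsum hBpos.le hN0 (htriv k) (hne hk2)
    refine hfin.trans ?_
    rw [← ENNReal.ofReal_mul (by positivity)]
    refine ENNReal.ofReal_le_ofReal ?_
    have hnr : 0 < (n : ℝ) ^ (-(1 - p / q)) := by positivity
    calc B * (2 * G * (n : ℝ) ^ (-(1 - p / q)))
        ≤ B * (H * (n : ℝ) ^ (-(1 - p / q))) := by gcongr
      _ = 4 * (B * H) * ((n : ℝ) ^ (-(1 - p / q)) * (1 / 4)) := by ring
      _ ≤ _ := by gcongr

end RateSum

/-! ### Projections: contraction and measurability. -/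

namespace Stiefel

variable {d k : ℕ}

/-- Expand `0 ≤ ‖x - E Eᵀ x‖² = ‖x‖² - ‖Eᵀ x‖²`. -/
lemma norm_proj_le (E : Stiefel d k) (x : EuclideanSpace ℝ (Fin d)) : ‖proj E x‖ ≤ ‖x‖ := by
  set u : Fin k → ℝ := E.1ᵀ *ᵥ x.ofLp with hu
  have h1 : ‖proj E x‖ ^ 2 = u ⬝ᵥ u := by
    rw [EuclideanSpace.norm_sq_eq]
    simp [proj, dotProduct, ← hu, pow_two]
  have h2 : ‖x‖ ^ 2 = x.ofLp ⬝ᵥ x.ofLp := by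
    rw [EuclideanSpace.norm_sq_eq]
    simp [dotProduct, pow_two]
  have h3 : x.ofLp ⬝ᵥ (E.1 *ᵥ u) = u ⬝ᵥ u := by
    rw [Matrix.dotProduct_mulVec, ← Matrix.mulVec_transpose]
  have h4 : (E.1 *ᵥ u) ⬝ᵥ (E.1 *ᵥ u) = u ⬝ᵥ u := by
    rw [Matrix.dotProduct_mulVec, ← Matrix.mulVec_transpose, Matrix.mulVec_mulVec, E.2,
      Matrix.one_mulVec]
  have h5 : 0 ≤ (x.ofLp - E.1 *ᵥ u) ⬝ᵥ (x.ofLp - E.1 *ᵥ u) := by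
    rw [dotProduct]
    exact Finset.sum_nonneg fun i _ => mul_self_nonneg _
  rw [sub_dotProduct, dotProduct_sub, dotProduct_sub, h4, h3,
    dotProduct_comm (E.1 *ᵥ u) x.ofLp, h3] at h5
  refine le_of_sq_le_sq ?_ (norm_nonneg x)
  rw [h1, h2]
  linarith

instance : SecondCountableTopology (Stiefel d k) := by
  let f : Stiefel d k → Fin d → Fin k → ℝ := fun E => E.1
  have hf : Topology.IsInducing f := ⟨rfl⟩
  exact hf.secondCountableTopology

lemma continuous_proj :
    Continuous fun z : Stiefel d k × EuclideanSpace ℝ (Fin d) => proj z.1 z.2 := by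
  have h1 : Continuous fun z : Stiefel d k × EuclideanSpace ℝ (Fin d) => z.1.1 :=
    continuous_subtype_val.comp continuous_fst
  have h2 : Continuous fun z : Stiefel d k × EuclideanSpace ℝ (Fin d) => z.2.ofLp :=
    (PiLp.continuous_ofLp 2 _).comp continuous_snd
  exact (PiLp.continuous_toLp 2 _).comp (h1.matrix_transpose.matrix_mulVec h2)

lemma measurable_proj_uncurry :
    Measurable fun z : Stiefel d k × EuclideanSpace ℝ (Fin d) => proj z.1 z.2 :=
  continuous_proj.measurable

lemma measurable_proj (E : Stiefel d k) : Measurable (proj E) :=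
  measurable_proj_uncurry.comp measurable_prodMk_left

end Stiefel

/-! ### From the multiscale bound to the projected distance. -/

section Transport

/-- Jensen, as monotonicity of the `L^p` norms of `f ^ (1 / p)` on a probability space. -/
lemma lintegral_rpow_one_div_le {α : Type*} [MeasurableSpace α] (P : Measure α)
    [IsProbabilityMeasure P] {p : ℝ} (hp : 1 ≤ p) {f : α → ℝ≥0∞} (hf : Measurable f) :
    ∫⁻ x, f x ^ (1 / p) ∂P ≤ (∫⁻ x, f x ∂P) ^ (1 / p) := by
  have h := eLpNorm'_le_eLpNorm'_of_exponent_le one_pos hp P (f := fun x => f x ^ (1 / p))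
    (hf.pow_const _).aestronglyMeasurable
  have hp0 : p ≠ 0 := by linarith
  simpa [eLpNorm', ← ENNReal.rpow_mul, hp0] using h

variable {d k n : ℕ} {p s : ℝ}

/-- A bound for the `p`-th power of the diameter of a cell of level `j` in the shell `m`. -/
noncomputable def cellCost (p s : ℝ) (j m : ℕ) : ℝ≥0∞ :=
  ENNReal.ofReal ((2 * (2 ^ m * s / 2 ^ j)) ^ p)

/-- The cell of level `j` of the projection of a point, as a set of pairs. -/
def cellSet (d : ℕ) {k : ℕ} (s : ℝ) (j : ℕ) (i : ℕ × (Fin k → ℤ)) :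
    Set (Stiefel d k × EuclideanSpace ℝ (Fin d)) :=
  {z | dyadicCell s j (Stiefel.proj z.1 z.2) = i}

lemma measurableSet_cellSet (s : ℝ) (j : ℕ) (i : ℕ × (Fin k → ℤ)) :
    MeasurableSet (cellSet d s j i) :=
  ((measurable_dyadicCell s j).comp Stiefel.measurable_proj_uncurry) (measurableSet_singleton i)

lemma measurableSet_cellSet_section (E : Stiefel d k) (s : ℝ) (j : ℕ) (i : ℕ × (Fin k → ℤ)) :
    MeasurableSet (Prod.mk E ⁻¹' cellSet d s j i) :=
  measurable_prodMk_left (measurableSet_cellSet s j i)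

/-- The multiscale upper bound for `W_p ^ p` between the projections of two measures. -/
noncomputable def multiscaleBound (p s : ℝ) (J : ℕ) (μ ν : Measure (EuclideanSpace ℝ (Fin d)))
    (E : Stiefel d k) : ℝ≥0∞ :=
  (∑' i, cellCost p s J i.1 * μ (Prod.mk E ⁻¹' cellSet d s J i)) +
    (∑ j ∈ Finset.range J, ∑' i, cellCost p s j i.1 *
      (μ (Prod.mk E ⁻¹' cellSet d s (j + 1) i) - ν (Prod.mk E ⁻¹' cellSet d s (j + 1) i))) +
    ((∑' i, cellCost p s 0 i.1 *
      (μ (Prod.mk E ⁻¹' cellSet d s 0 i) - ν (Prod.mk E ⁻¹' cellSet d s 0 i))) +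
    ∑' i, cellCost p s 0 i.1 *
      (ν (Prod.mk E ⁻¹' cellSet d s 0 i) - μ (Prod.mk E ⁻¹' cellSet d s 0 i)))

lemma enorm_rpow_le_cellCost {x : EuclideanSpace ℝ (Fin k)} (hp : 0 ≤ p) {j m : ℕ}
    (h : ‖x‖ ≤ 2 * (2 ^ m * s / 2 ^ j)) : ‖x‖ₑ ^ p ≤ cellCost p s j m := by
  rw [cellCost, ← ofReal_norm, ENNReal.ofReal_rpow_of_nonneg (norm_nonneg _) hp]
  exact ENNReal.ofReal_le_ofReal (Real.rpow_le_rpow (norm_nonneg _) h hp)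

lemma enorm_sub_rpow_le (hp : 0 ≤ p) (hs : 0 < s) (x y : EuclideanSpace ℝ (Fin k)) :
    ‖x - y‖ₑ ^ p ≤ cellCost p s 0 (shell s x) + cellCost p s 0 (shell s y) := by
  have hx := norm_le_of_shell hs x
  have hy := norm_le_of_shell hs y
  have hxy := norm_sub_le x y
  rcases le_total (‖x‖) (‖y‖) with h | h
  · refine (enorm_rpow_le_cellCost hp ?_).trans le_add_self
    rw [pow_zero, div_one]
    linarith
  · refine (enorm_rpow_le_cellCost hp ?_).trans le_self_add
    rw [pow_zero, div_one]
    linarith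

lemma wasserstein_rpow_le (hp : 1 ≤ p) (hs : 0 < s) (J : ℕ)
    (μ ν : Measure (EuclideanSpace ℝ (Fin d))) [IsProbabilityMeasure μ] [IsProbabilityMeasure ν]
    (E : Stiefel d k) :
    wasserstein p (μ.map (Stiefel.proj E)) (ν.map (Stiefel.proj E)) ^ p ≤
      multiscaleBound p s J μ ν E := by
  have hE := Stiefel.measurable_proj E
  have : IsProbabilityMeasure (μ.map (Stiefel.proj E)) :=
    Measure.isProbabilityMeasure_map hE.aemeasurable
  have : IsProbabilityMeasure (ν.map (Stiefel.proj E)) :=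
    Measure.isProbabilityMeasure_map hE.aemeasurable
  obtain ⟨γ, h1, h2, hγ⟩ := exists_multiscale_coupling
    (fun x y : EuclideanSpace ℝ (Fin k) => ‖x - y‖ₑ ^ p) (φ := dyadicCell s)
    (measurable_dyadicCell s) (fun _ _ => rfl) (dyadicCell_nested s) (cellCost p s)
    (fun j x y h => enorm_rpow_le_cellCost (by linarith) (norm_sub_le_of_dyadicCell_eq hs j x y h))
    (cellCost p s 0) (enorm_sub_rpow_le (by linarith) hs) J
    (μ.map (Stiefel.proj E)) (ν.map (Stiefel.proj E)) (by rw [measure_univ, measure_univ])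
  have hmap : ∀ (ρ : Measure (EuclideanSpace ℝ (Fin d))) (j : ℕ) (i : ℕ × (Fin k → ℤ)),
      ρ.map (Stiefel.proj E) (dyadicCell s j ⁻¹' {i}) = ρ (Prod.mk E ⁻¹' cellSet d s j i) := by
    intro ρ j i
    rw [Measure.map_apply hE (measurable_dyadicCell s j (measurableSet_singleton i))]
    rfl
  simp only [hmap] at hγ
  rw [wasserstein, ← ENNReal.rpow_mul, one_div_mul_cancel (by linarith), ENNReal.rpow_one]
  exact (iInf₂_le γ ⟨h1, h2⟩).trans hγ

lemma iprw_empirical_le (h : k ≤ d) (hn : 0 < n) (hp : 1 ≤ p) (hs : 0 < s) (J : ℕ)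
    (μ : Measure (EuclideanSpace ℝ (Fin d))) [IsProbabilityMeasure μ]
    (x : Fin n → EuclideanSpace ℝ (Fin d)) :
    iprw h p (empirical x) μ ≤
      (∫⁻ E, multiscaleBound p s J (empirical x) μ E ∂(Stiefel.uniform h)) ^ (1 / p) := by
  have := isProbabilityMeasure_empirical hn x
  refine ENNReal.rpow_le_rpow (lintegral_mono fun E => ?_) (by positivity)
  exact wasserstein_rpow_le hp hs J _ _ E

/-- Tonelli and Jensen are applied only to this majorant, so measurability of the Wasserstein
integrand is never needed. -/
lemma measurable_multiscaleBound (p s : ℝ) (J : ℕ) (μ : Measure (EuclideanSpace ℝ (Fin d)))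
    [SFinite μ] :
    Measurable fun z : (Fin n → EuclideanSpace ℝ (Fin d)) × Stiefel d k =>
      multiscaleBound p s J (empirical z.1) μ z.2 := by
  have h1 : ∀ j i, Measurable fun z : (Fin n → EuclideanSpace ℝ (Fin d)) × Stiefel d k =>
      μ (Prod.mk z.2 ⁻¹' cellSet d s j i) := fun j i =>
    (measurable_measure_prodMk_left (measurableSet_cellSet s j i)).comp measurable_snd
  have h2 : ∀ j i, Measurable fun z : (Fin n → EuclideanSpace ℝ (Fin d)) × Stiefel d k =>
      empirical z.1 (Prod.mk z.2 ⁻¹' cellSet d s j i) := by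
    intro j i
    simp only [empirical_apply _ (measurableSet_cellSet_section _ s j i)]
    refine (Finset.measurable_sum _ fun a _ => ?_).const_mul _
    have h3 : Measurable fun z : (Fin n → EuclideanSpace ℝ (Fin d)) × Stiefel d k =>
        (z.2, z.1 a) := by fun_prop
    exact (measurable_one.indicator (measurableSet_cellSet s j i)).comp h3
  unfold multiscaleBound
  refine Measurable.add (Measurable.add ?_ ?_) (Measurable.add ?_ ?_)
  · exact Measurable.tsum fun i => (h2 _ _).const_mul _
  · exact Finset.measurable_sum _ fun j _ =>
      Measurable.tsum fun i => ((h2 _ _).sub (h1 _ _)).const_mul _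
  · exact Measurable.tsum fun i => ((h2 _ _).sub (h1 _ _)).const_mul _
  · exact Measurable.tsum fun i => ((h1 _ _).sub (h2 _ _)).const_mul _

/-- Reduction to a bound of the multiscale sums that is uniform over the directions. -/
lemma lintegral_iprw_le (h : k ≤ d) (hn : 0 < n) (hp : 1 ≤ p) (hs : 0 < s) (J : ℕ)
    (μ : Measure (EuclideanSpace ℝ (Fin d))) [IsProbabilityMeasure μ] {R : ℝ≥0∞}
    (hR : ∀ E : Stiefel d k, ∫⁻ x, multiscaleBound p s J (empirical x) μ E
      ∂(Measure.pi fun _ : Fin n => μ) ≤ R)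
    {Ω : Type*} [MeasurableSpace Ω] (P : Measure Ω) [IsProbabilityMeasure P]
    (X : Fin n → Ω → EuclideanSpace ℝ (Fin d)) (hX : iIndepFun X P)
    (hlaw : ∀ i, HasLaw (X i) μ P) :
    ∫⁻ ω, iprw h p (empirical fun i => X i ω) μ ∂P ≤ R ^ (1 / p) := by
  set V : (Fin n → EuclideanSpace ℝ (Fin d)) → ℝ≥0∞ := fun x =>
    ∫⁻ E, multiscaleBound p s J (empirical x) μ E ∂(Stiefel.uniform h) with hV
  have hVm : Measurable V := (measurable_multiscaleBound p s J μ).lintegral_prod_right'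
  have hmap : P.map (fun ω i => X i ω) = Measure.pi fun _ : Fin n => μ := by
    rw [(iIndepFun_iff_map_fun_eq_pi_map fun i => (hlaw i).aemeasurable).1 hX]
    simp only [fun i => (hlaw i).map_eq]
  calc ∫⁻ ω, iprw h p (empirical fun i => X i ω) μ ∂P
      ≤ ∫⁻ ω, V (fun i => X i ω) ^ (1 / p) ∂P :=
        lintegral_mono fun ω => iprw_empirical_le h hn hp hs J μ _
    _ = ∫⁻ x, V x ^ (1 / p) ∂(Measure.pi fun _ : Fin n => μ) := by
        rw [← hmap, lintegral_map' (f := fun x => V x ^ (1 / p)) (hVm.pow_const _).aemeasurable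
          (aemeasurable_pi_lambda _ fun i => (hlaw i).aemeasurable)]
    _ ≤ (∫⁻ x, V x ∂(Measure.pi fun _ : Fin n => μ)) ^ (1 / p) :=
        lintegral_rpow_one_div_le _ hp hVm
    _ ≤ R ^ (1 / p) := by
        refine ENNReal.rpow_le_rpow ?_ (by positivity)
        rw [hV, lintegral_lintegral_swap (measurable_multiscaleBound p s J μ).aemeasurable]
        refine (lintegral_mono hR).trans ?_
        simp

end Transport

/-! ### Expectation of the multiscale bound in a fixed direction. -/

section Expectation

variable {d k n : ℕ} {p q s : ℝ}

/-- The mass of the shell `m` for the projection of `μ`. -/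
noncomputable def shellMass (s : ℝ) (μ : Measure (EuclideanSpace ℝ (Fin d))) (E : Stiefel d k)
    (m : ℕ) : ℝ :=
  μ.real {y | shell s (Stiefel.proj E y) = m}

lemma lintegral_tsum_cell_le (hs : 0 < s) (μ : Measure (EuclideanSpace ℝ (Fin d)))
    [IsProbabilityMeasure μ] (E : Stiefel d k) (j : ℕ) (c : ℕ → ℝ≥0∞) {N : ℝ}
    (hN : (18 * 2 ^ j) ^ k ≤ N)
    {D : ℕ × (Fin k → ℤ) → (Fin n → EuclideanSpace ℝ (Fin d)) → ℝ≥0∞} (hDm : ∀ i, Measurable (D i))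
    (hD : ∀ i, ∫⁻ x, D i x ∂(Measure.pi fun _ : Fin n => μ) ≤ ENNReal.ofReal
      (min (μ.real (Prod.mk E ⁻¹' cellSet d s j i)) √(μ.real (Prod.mk E ⁻¹' cellSet d s j i) / n))) :
    ∫⁻ x, ∑' i, c i.1 * D i x ∂(Measure.pi fun _ : Fin n => μ) ≤
      ∑' m, c m * ENNReal.ofReal (min (shellMass s μ E m) √(N * shellMass s μ E m / n)) := by
  rw [lintegral_tsum fun i => ((hDm i).const_mul _).aemeasurable, ENNReal.tsum_prod']
  refine ENNReal.tsum_le_tsum fun m => ?_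
  simp only [lintegral_const_mul _ (hDm _)]
  rw [ENNReal.tsum_mul_left]
  gcongr
  obtain ⟨F, hF, hmem⟩ := exists_finset_dyadicCell k hs j
  exact tsum_fiber_le μ (ψ := fun y => dyadicCell s j (Stiefel.proj E y))
    ((measurable_dyadicCell s j).comp (Stiefel.measurable_proj E)) (fun y => hmem _) (hF.trans hN) m
    fun z => hD (m, z)

/-- Mass unmatched at level `j + 1` pays the diameter of level `j`, whence `18 * 2 ^ (j + 1) = 36 *
2 ^ j`. The factor `3` counts the sum over levels and the two remainders of level `0`. -/
lemma lintegral_multiscaleBound_le (hn : 0 < n) (hs : 0 < s) (J : ℕ)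
    (μ : Measure (EuclideanSpace ℝ (Fin d))) [IsProbabilityMeasure μ] (E : Stiefel d k) :
    ∫⁻ x, multiscaleBound p s J (empirical x) μ E ∂(Measure.pi fun _ : Fin n => μ) ≤
      (∑' m, cellCost p s J m * ENNReal.ofReal (shellMass s μ E m)) +
      3 * ∑' m, ∑' j, cellCost p s j m * ENNReal.ofReal
        (min (shellMass s μ E m) √((36 * 2 ^ j) ^ (k : ℝ) * shellMass s μ E m / n)) := by
  have hS := fun j i => measurableSet_cellSet_section E s j i
  have hm1 : ∀ j i, Measurable fun x : Fin n → EuclideanSpace ℝ (Fin d) =>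
      empirical x (Prod.mk E ⁻¹' cellSet d s j i) := fun j i => measurable_empirical_apply (hS j i)
  have hm2 : ∀ j i, Measurable fun x : Fin n → EuclideanSpace ℝ (Fin d) =>
      empirical x (Prod.mk E ⁻¹' cellSet d s j i) - μ (Prod.mk E ⁻¹' cellSet d s j i) :=
    fun j i => (hm1 j i).sub measurable_const
  have hm3 : ∀ j i, Measurable fun x : Fin n → EuclideanSpace ℝ (Fin d) =>
      μ (Prod.mk E ⁻¹' cellSet d s j i) - empirical x (Prod.mk E ⁻¹' cellSet d s j i) :=
    fun j i => measurable_const.sub (hm1 j i)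
  have hM1 : ∀ c : ℕ → ℝ≥0∞, ∀ j, Measurable fun x : Fin n → EuclideanSpace ℝ (Fin d) =>
      ∑' i : ℕ × (Fin k → ℤ), c i.1 * empirical x (Prod.mk E ⁻¹' cellSet d s j i) := fun c j =>
    Measurable.tsum fun i => (hm1 j i).const_mul _
  have hM2 : ∀ c : ℕ → ℝ≥0∞, ∀ j, Measurable fun x : Fin n → EuclideanSpace ℝ (Fin d) =>
      ∑' i : ℕ × (Fin k → ℤ), c i.1 * (empirical x (Prod.mk E ⁻¹' cellSet d s j i) -
        μ (Prod.mk E ⁻¹' cellSet d s j i)) := fun c j =>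
    Measurable.tsum fun i => (hm2 j i).const_mul _
  have hbase : ∀ j : ℕ, (18 * 2 ^ j : ℝ) ^ k ≤ (36 * 2 ^ j) ^ (k : ℝ) := by
    intro j
    rw [Real.rpow_natCast]
    gcongr
    norm_num
  have hsucc : ∀ j : ℕ, (18 * 2 ^ (j + 1) : ℝ) ^ k ≤ (36 * 2 ^ j) ^ (k : ℝ) := by
    intro j
    rw [Real.rpow_natCast]
    refine pow_le_pow_left₀ (by positivity) (le_of_eq ?_) k
    ring
  set T : ℕ → ℝ≥0∞ := fun j => ∑' m, cellCost p s j m * ENNReal.ofReal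
    (min (shellMass s μ E m) √((36 * 2 ^ j) ^ (k : ℝ) * shellMass s μ E m / n)) with hT
  have hTsum : ∑' m, ∑' j, cellCost p s j m * ENNReal.ofReal
      (min (shellMass s μ E m) √((36 * 2 ^ j) ^ (k : ℝ) * shellMass s μ E m / n)) = ∑' j, T j :=
    ENNReal.tsum_comm
  rw [hTsum]
  unfold multiscaleBound
  have hM3 : Measurable fun x : Fin n → EuclideanSpace ℝ (Fin d) =>
      (∑' i : ℕ × (Fin k → ℤ), cellCost p s J i.1 * empirical x (Prod.mk E ⁻¹' cellSet d s J i)) +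
      ∑ j ∈ Finset.range J, ∑' i : ℕ × (Fin k → ℤ), cellCost p s j i.1 *
        (empirical x (Prod.mk E ⁻¹' cellSet d s (j + 1) i) -
          μ (Prod.mk E ⁻¹' cellSet d s (j + 1) i)) :=
    (hM1 (cellCost p s J) J).add (Finset.measurable_sum _ fun j _ => hM2 (cellCost p s j) (j + 1))
  rw [lintegral_add_left hM3, lintegral_add_left (hM1 (cellCost p s J) J),
    lintegral_add_left (hM2 (cellCost p s 0) 0), add_assoc,
    lintegral_finsetSum _ fun j _ => hM2 (cellCost p s j) (j + 1)]
  refine add_le_add ?_ ?_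
  · rw [lintegral_tsum fun i => ((hm1 J i).const_mul _).aemeasurable]
    simp only [lintegral_const_mul _ (hm1 _ _), lintegral_empirical_apply μ hn (hS _ _)]
    refine (lintegral_comp_countable μ (φ := fun y => dyadicCell s J (Stiefel.proj E y))
      ((measurable_dyadicCell s J).comp (Stiefel.measurable_proj E))
      (fun i => cellCost p s J i.1)).symm.le.trans ?_
    refine (lintegral_comp_countable μ (φ := fun y => shell s (Stiefel.proj E y))
      ((measurable_shell s).comp (Stiefel.measurable_proj E)) (cellCost p s J)).le.trans ?_
    refine ENNReal.tsum_le_tsum fun m => ?_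
    rw [shellMass, ofReal_measureReal]
    rfl
  · have h1 : ∑ j ∈ Finset.range J, ∫⁻ x, ∑' i : ℕ × (Fin k → ℤ), cellCost p s j i.1 *
        (empirical x (Prod.mk E ⁻¹' cellSet d s (j + 1) i) -
          μ (Prod.mk E ⁻¹' cellSet d s (j + 1) i)) ∂(Measure.pi fun _ : Fin n => μ) ≤ ∑' j, T j :=
      (Finset.sum_le_sum fun j _ => lintegral_tsum_cell_le hs μ E (j + 1) _ (hsucc j) (hm2 (j + 1))
        fun i => lintegral_empirical_tsub_le μ hn (hS _ _)).trans (ENNReal.sum_le_tsum _)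
    have h2 := (lintegral_tsum_cell_le hs μ E 0 (cellCost p s 0) (hbase 0) (hm2 0)
        fun i => lintegral_empirical_tsub_le μ hn (hS _ _)).trans (ENNReal.le_tsum (f := T) 0)
    have h3 := (lintegral_tsum_cell_le hs μ E 0 (cellCost p s 0) (hbase 0) (hm3 0)
        fun i => lintegral_tsub_empirical_le μ hn (hS _ _)).trans (ENNReal.le_tsum (f := T) 0)
    refine (add_le_add h1 (add_le_add h2 h3)).trans (le_of_eq ?_)
    ring

lemma cellCost_eq (hs : 0 < s) (j m : ℕ) :
    cellCost p s j m = ENNReal.ofReal ((2 * s) ^ p) *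
      (ENNReal.ofReal ((2 : ℝ) ^ (p * m)) * ENNReal.ofReal ((2 : ℝ) ^ (-p * j))) := by
  rw [cellCost, ← ENNReal.ofReal_mul (by positivity), ← ENNReal.ofReal_mul (by positivity)]
  congr 1
  have h1 : 2 * (2 ^ m * s / 2 ^ j) = (2 * s) * (2 ^ m * (2 ^ j)⁻¹) := by ring
  rw [h1, Real.mul_rpow (by positivity) (by positivity), Real.mul_rpow (x := (2 : ℝ) ^ m)
    (by positivity) (by positivity), Real.inv_rpow (by positivity), ← Real.rpow_natCast_mul (by norm_num),
    ← Real.rpow_natCast_mul (by norm_num), ← Real.rpow_neg (by norm_num)]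
  congr 3
  · rw [mul_comm]
  · rw [neg_mul, mul_comm]

/-- Markov-type bound: the moment of order `q` of `2 ^ shell`. -/
lemma tsum_shellMass_le (hs : 0 < s) (hq : 0 ≤ q) (μ : Measure (EuclideanSpace ℝ (Fin d)))
    [IsProbabilityMeasure μ] (E : Stiefel d k) (hμ : absMoment q μ ≤ ENNReal.ofReal (s ^ q)) :
    ∑' m : ℕ, ENNReal.ofReal ((2 : ℝ) ^ (q * m)) * ENNReal.ofReal (shellMass s μ E m) ≤
      ENNReal.ofReal (1 + 2 ^ q) := by
  have h0 : ∑' m : ℕ, ENNReal.ofReal ((2 : ℝ) ^ (q * m)) * ENNReal.ofReal (shellMass s μ E m) =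
      ∫⁻ y, ENNReal.ofReal ((2 : ℝ) ^ (q * shell s (Stiefel.proj E y))) ∂μ := by
    refine Eq.trans ?_ (lintegral_comp_countable μ (φ := fun y => shell s (Stiefel.proj E y))
      ((measurable_shell s).comp (Stiefel.measurable_proj E))
      (fun m : ℕ => ENNReal.ofReal ((2 : ℝ) ^ (q * m)))).symm
    refine tsum_congr fun m => ?_
    rw [shellMass, ofReal_measureReal]
    rfl
  rw [h0]
  -- Shell `0` accounts for the `1`; elsewhere `2 ^ shell` is at most `2 ‖Eᵀ y‖ / s ≤ 2 ‖y‖ / s`,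
  -- which no longer depends on `E`.
  have hpt : ∀ y : EuclideanSpace ℝ (Fin d),
      ENNReal.ofReal ((2 : ℝ) ^ (q * shell s (Stiefel.proj E y))) ≤
      1 + ENNReal.ofReal ((2 / s) ^ q) * ‖y‖ₑ ^ q := by
    intro y
    rw [← ofReal_norm, ENNReal.ofReal_rpow_of_nonneg (norm_nonneg _) hq,
      ← ENNReal.ofReal_mul (by positivity), ← ENNReal.ofReal_one,
      ← ENNReal.ofReal_add (by norm_num) (by positivity)]
    refine ENNReal.ofReal_le_ofReal ?_
    rw [mul_comm q, Real.rpow_natCast_mul (by norm_num), ← Real.mul_rpow (by positivity)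
      (norm_nonneg _)]
    have h1 := two_pow_shell_le s (Stiefel.proj E y)
    have h2 : 2 * ‖Stiefel.proj E y‖ / s ≤ 2 / s * ‖y‖ := by
      have := Stiefel.norm_proj_le E y
      calc 2 * ‖Stiefel.proj E y‖ / s ≤ 2 * ‖y‖ / s := by gcongr
        _ = _ := by ring
    refine (Real.rpow_le_rpow (by positivity) (h1.trans (max_le_max le_rfl h2)) hq).trans ?_
    have h3 : (0 : ℝ) ≤ (2 / s * ‖y‖) ^ q := by positivity
    rcases le_total 1 (2 / s * ‖y‖) with h | h
    · rw [max_eq_right h]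
      linarith
    · rw [max_eq_left h, Real.one_rpow]
      linarith
  refine (lintegral_mono hpt).trans ?_
  rw [lintegral_add_left measurable_const, lintegral_const_mul' _ _ ENNReal.ofReal_ne_top,
    lintegral_one, measure_univ, ENNReal.ofReal_add (by norm_num) (by positivity),
    ENNReal.ofReal_one]
  gcongr
  refine (mul_le_mul_right hμ _).trans (le_of_eq ?_)
  rw [← ENNReal.ofReal_mul (by positivity), ← Real.mul_rpow (by positivity) hs.le]
  congr 2
  field_simp

/-- The multiscale sum for a sequence `P` of shell masses with a bounded moment of order `q`. -/
lemma exists_tsum_shell_le (p q : ℝ) (hp : 1 ≤ p) (hpq : p ≤ q) :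
    ∃ C : ℝ, 0 < C ∧ ∀ k n : ℕ, 1 ≤ k → (2 ≤ n ∨ (n = 1 ∧ zeta p q k = 0)) →
      ∀ (K : ℝ) (P : ℕ → ℝ), 1 ≤ K → (∀ m, 0 ≤ P m) →
      ∑' m : ℕ, ENNReal.ofReal ((2 : ℝ) ^ (q * m)) * ENNReal.ofReal (P m) ≤ ENNReal.ofReal K →
      ∑' m : ℕ, ENNReal.ofReal ((2 : ℝ) ^ (p * m)) * levelSum p 36 k n (P m) ≤
        ENNReal.ofReal (K * (C * ((n : ℝ) ^ (-(min (p / max (2 * p) (k : ℝ)) (1 - p / q))) *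
          Real.log n ^ zeta p q k))) := by
  have hp0 : 0 < p := by linarith
  rcases hpq.eq_or_lt with rfl | hpq
  -- For `q = p` the rate exponent is `0`, and the moment sums the trivial bounds over the shells
  -- directly.
  · have hG := geomConst_pos hp0
    refine ⟨4 * geomConst p, by positivity, fun k n _ hn K P hK hP hsum => ?_⟩
    have hq4 := quarter_le_log_rpow hn
    have hexp : min (p / max (2 * p) (k : ℝ)) (1 - p / p) = 0 := by
      rw [div_self hp0.ne', sub_self]
      exact min_eq_right (by positivity)
    rw [hexp, neg_zero, Real.rpow_zero, one_mul]
    calc _ ≤ ∑' m : ℕ, ENNReal.ofReal (geomConst p) *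
          (ENNReal.ofReal ((2 : ℝ) ^ (p * m)) * ENNReal.ofReal (P m)) := by
          refine ENNReal.tsum_le_tsum fun m => ?_
          rw [mul_left_comm, ← ENNReal.ofReal_mul hG.le]
          gcongr
          exact levelSum_le_trivial hp0 le_rfl (hP m)
      _ ≤ ENNReal.ofReal (geomConst p) * ENNReal.ofReal K := by
          rw [ENNReal.tsum_mul_left]
          gcongr
      _ ≤ _ := by
          rw [← ENNReal.ofReal_mul hG.le]
          refine ENNReal.ofReal_le_ofReal ?_
          calc geomConst p * K = K * (4 * geomConst p * (1 / 4)) := by ring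
            _ ≤ _ := by gcongr
  · obtain ⟨C, hC, h⟩ := exists_rateSum_le p q hp hpq 36 (by norm_num)
    refine ⟨C, hC, fun k n hk hn K P hK hP hsum => ?_⟩
    have hK0 : 0 < K := by linarith
    rw [ENNReal.ofReal_mul hK0.le]
    refine le_trans ?_ (mul_le_mul_right (h k n hk hn) _)
    rw [rateSum, ← ENNReal.tsum_mul_left]
    refine ENNReal.tsum_le_tsum fun m => ?_
    rw [mul_left_comm]
    refine mul_le_mul_right ?_ _
    -- Markov: a single term of the moment series is at most `K`. Since `K ≥ 1`, the factor `K` also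
    -- comes out of the square root below.
    have hPm : P m ≤ K * (2 : ℝ) ^ (-q * m) := by
      have h1 := (ENNReal.le_tsum m).trans hsum
      rw [← ENNReal.ofReal_mul (by positivity), ENNReal.ofReal_le_ofReal_iff hK0.le] at h1
      rw [neg_mul, Real.rpow_neg (by norm_num), ← div_eq_mul_inv, le_div_iff₀ (by positivity)]
      linarith
    rw [levelSum, levelSum, ← ENNReal.tsum_mul_left]
    refine ENNReal.tsum_le_tsum fun l => ?_
    rw [← ENNReal.ofReal_mul hK0.le]
    refine ENNReal.ofReal_le_ofReal ?_
    rw [mul_left_comm, mul_min_of_nonneg _ _ hK0.le]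
    refine mul_le_mul_of_nonneg_left (min_le_min hPm ?_) (by positivity)
    set ε := (2 : ℝ) ^ (-q * m)
    have hε : 0 < ε := by positivity
    calc √((36 * 2 ^ l) ^ (k : ℝ) * P m / n)
        ≤ √(K ^ 2 * ((36 * 2 ^ l) ^ (k : ℝ) * ε / n)) := by
          refine Real.sqrt_le_sqrt ?_
          rw [← mul_div_assoc]
          refine div_le_div_of_nonneg_right ?_ (by positivity)
          calc _ ≤ (36 * 2 ^ l : ℝ) ^ (k : ℝ) * (K * ε) := by gcongr
            _ ≤ (36 * 2 ^ l : ℝ) ^ (k : ℝ) * (K ^ 2 * ε) := by gcongr; nlinarith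
            _ = _ := by ring
      _ = _ := by rw [Real.sqrt_mul (by positivity), Real.sqrt_sq hK0.le]

/-- The uniform bound over directions for the expected multiscale sum. -/
lemma exists_lintegral_multiscaleBound_le (p q : ℝ) (hp : 1 ≤ p) (hpq : p ≤ q) :
    ∃ C : ℝ, 0 < C ∧ ∀ (d k n : ℕ), 1 ≤ k → (2 ≤ n ∨ (n = 1 ∧ zeta p q k = 0)) →
      ∀ (s : ℝ), 0 < s → ∀ (μ : Measure (EuclideanSpace ℝ (Fin d))) [IsProbabilityMeasure μ],
      absMoment q μ ≤ ENNReal.ofReal (s ^ q) → ∀ E : Stiefel d k,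
      ∫⁻ x, multiscaleBound p s n (empirical x) μ E ∂(Measure.pi fun _ : Fin n => μ) ≤
        ENNReal.ofReal (C * s ^ p * ((n : ℝ) ^ (-(min (p / max (2 * p) (k : ℝ)) (1 - p / q))) *
          Real.log n ^ zeta p q k)) := by
  obtain ⟨C, hC, hsum⟩ := exists_tsum_shell_le p q hp hpq
  have hp0 : 0 < p := by linarith
  have hq0 : 0 < q := by linarith
  set K : ℝ := 1 + 2 ^ q with hK
  have hK1 : 1 ≤ K := by
    have : (0 : ℝ) < 2 ^ q := by positivity
    linarith
  have hK0 : 0 < K := by linarith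
  refine ⟨2 ^ p * K * (4 + 3 * C), by positivity, fun d k n hk hn s hs μ _ hμ E => ?_⟩
  have hn1 : 1 ≤ n := by omega
  have hN : (1 : ℝ) ≤ n := by exact_mod_cast hn1
  have hN0 : (0 : ℝ) < n := by linarith
  set α := min (p / max (2 * p) (k : ℝ)) (1 - p / q) with hα
  have hmass := tsum_shellMass_le hs hq0.le μ E hμ
  have hP0 : ∀ m, 0 ≤ shellMass s μ E m := fun m => measureReal_nonneg
  have h2 := hsum k n hk hn K (shellMass s μ E) hK1 hP0 hmass
  have hq4 := quarter_le_log_rpow hn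
  have hα1 : α ≤ 1 := by
    refine (min_le_right _ _).trans ?_
    have : 0 < p / q := by positivity
    linarith
  -- Taking `J = n` levels suffices: the truncation term is at most `1 / n`, and the rate exponent
  -- never exceeds `1`.
  have hJ : (2 : ℝ) ^ (-p * n) ≤ 4 * ((n : ℝ) ^ (-α) * Real.log n ^ zeta p q k) := by
    have h3 : (2 : ℝ) ^ (-p * n) ≤ (n : ℝ) ^ (-α) := by
      calc (2 : ℝ) ^ (-p * n) ≤ (2 : ℝ) ^ (-(n : ℝ)) := two_rpow_le_two_rpow (by nlinarith)
        _ = ((2 : ℝ) ^ n)⁻¹ := by rw [Real.rpow_neg (by norm_num), Real.rpow_natCast]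
        _ ≤ (n : ℝ)⁻¹ := by
            gcongr
            exact_mod_cast Nat.lt_two_pow_self.le
        _ = (n : ℝ) ^ (-1 : ℝ) := (Real.rpow_neg_one _).symm
        _ ≤ _ := Real.rpow_le_rpow_of_exponent_le hN (by linarith)
    have h4 : 0 < (n : ℝ) ^ (-α) := by positivity
    nlinarith
  set ρ := (n : ℝ) ^ (-α) * Real.log n ^ zeta p q k with hρ
  have hρ0 : 0 ≤ ρ := by positivity
  have e1 : ∑' m, cellCost p s n m * ENNReal.ofReal (shellMass s μ E m) ≤
      ENNReal.ofReal ((2 * s) ^ p) * ENNReal.ofReal (4 * ρ * K) := by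
    simp only [cellCost_eq hs, mul_assoc]
    rw [ENNReal.tsum_mul_left]
    gcongr
    calc _ ≤ ∑' m : ℕ, ENNReal.ofReal ((2 : ℝ) ^ (-p * n)) *
          (ENNReal.ofReal ((2 : ℝ) ^ (q * m)) * ENNReal.ofReal (shellMass s μ E m)) := by
          refine ENNReal.tsum_le_tsum fun m => ?_
          rw [mul_left_comm]
          gcongr
          norm_num
      _ ≤ ENNReal.ofReal (4 * ρ) * ENNReal.ofReal K := by
          rw [ENNReal.tsum_mul_left]
          gcongr
      _ = _ := by rw [← ENNReal.ofReal_mul (by positivity), mul_assoc]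
  have e2 : ∑' m, ∑' j, cellCost p s j m * ENNReal.ofReal
      (min (shellMass s μ E m) √((36 * 2 ^ j) ^ (k : ℝ) * shellMass s μ E m / n)) ≤
      ENNReal.ofReal ((2 * s) ^ p) * ENNReal.ofReal (K * (C * ρ)) := by
    refine le_trans (le_of_eq ?_) (mul_le_mul_right h2 _)
    rw [← ENNReal.tsum_mul_left]
    refine tsum_congr fun m => ?_
    rw [levelSum, ← ENNReal.tsum_mul_left, ← ENNReal.tsum_mul_left]
    refine tsum_congr fun j => ?_
    rw [cellCost_eq hs, ENNReal.ofReal_mul (p := (2 : ℝ) ^ (-p * j)) (by positivity)]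
    ring
  refine (lintegral_multiscaleBound_le hn1 hs n μ E).trans ?_
  refine (add_le_add e1 (mul_le_mul_right e2 3)).trans (le_of_eq ?_)
  rw [show (3 : ℝ≥0∞) = ENNReal.ofReal 3 by simp, ← ENNReal.ofReal_mul (by positivity),
    ← ENNReal.ofReal_mul (by positivity), ← ENNReal.ofReal_mul (by positivity),
    ← ENNReal.ofReal_add (by positivity) (by positivity), Real.mul_rpow (by norm_num) hs.le]
  congr 1
  ring

end Expectation

/-! ### Conclusion. -/

lemma rate_rpow_one_div {p q : ℝ} (hp : 1 ≤ p) (k n : ℕ) (hn : 1 ≤ n) :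
    ((n : ℝ) ^ (-(min (p / max (2 * p) (k : ℝ)) (1 - p / q))) *
      Real.log n ^ zeta p q k) ^ (1 / p) = iprwRate p q k n := by
  have hp0 : 0 < p := by linarith
  have hlog : 0 ≤ Real.log n := Real.log_nonneg (by exact_mod_cast hn)
  rw [Real.mul_rpow (by positivity) (by positivity), ← Real.rpow_mul (by positivity),
    ← Real.rpow_mul hlog, iprwRate, mul_one_div, mul_one_div]
  congr 2
  rw [neg_div, ← min_div_div_right hp0.le]
  congr 2
  · field_simp
  · field_simp

theorem mainTheorem2 (p q : ℝ) (hp : 1 ≤ p) (hpq : p ≤ q) :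
    ∃ C : ℝ, 0 < C ∧
      ∀ (d k : ℕ) (_ : 1 ≤ k) (hkd : k ≤ d)
        (μ : Measure (EuclideanSpace ℝ (Fin d))) [IsProbabilityMeasure μ],
        absMoment q μ < ∞ →
        ∀ n : ℕ, 2 ≤ n ∨ (n = 1 ∧ zeta p q k = 0) →
        ∀ {Ω : Type*} [MeasurableSpace Ω] (P : Measure Ω) [IsProbabilityMeasure P]
          (X : Fin n → Ω → EuclideanSpace ℝ (Fin d)),
          iIndepFun X P → (∀ i, HasLaw (X i) μ P) →
          ∫⁻ ω, iprw hkd p (empirical fun i => X i ω) μ ∂P ≤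
            ENNReal.ofReal C * absMoment q μ ^ (1 / q) * ENNReal.ofReal (iprwRate p q k n) := by
  obtain ⟨C, hC, hbound⟩ := exists_lintegral_multiscaleBound_le p q hp hpq
  have hp0 : 0 < p := by linarith
  have hq0 : 0 < q := by linarith
  refine ⟨C ^ (1 / p), by positivity, fun d k hk hkd μ _ hμ n hn Ω _ P _ X hX hlaw => ?_⟩
  have hn1 : 1 ≤ n := by omega
  have hlog : 0 ≤ Real.log n := Real.log_nonneg (by exact_mod_cast hn1)
  have hrate : 0 ≤ iprwRate p q k n := by
    rw [iprwRate]
    positivity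
  set M : ℝ := (absMoment q μ ^ (1 / q)).toReal with hM
  have hMfin : absMoment q μ ^ (1 / q) ≠ ∞ :=
    ENNReal.rpow_ne_top_of_nonneg (by positivity) hμ.ne
  have hMeq : absMoment q μ ^ (1 / q) = ENNReal.ofReal M := (ENNReal.ofReal_toReal hMfin).symm
  have hM0 : 0 ≤ M := ENNReal.toReal_nonneg
  -- The cells need a positive scale while `M` may vanish, so the bound is proved for `s > M` and
  -- then `s` decreases to `M`.
  have hmain : ∀ s : ℝ, M < s → ∫⁻ ω, iprw hkd p (empirical fun i => X i ω) μ ∂P ≤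
      ENNReal.ofReal (C ^ (1 / p) * s * iprwRate p q k n) := by
    intro s hs
    have hs0 : 0 < s := hM0.trans_lt hs
    have hμs : absMoment q μ ≤ ENNReal.ofReal (s ^ q) := by
      rw [← ENNReal.ofReal_rpow_of_nonneg hs0.le hq0.le]
      calc absMoment q μ = (absMoment q μ ^ (1 / q)) ^ q := by
            rw [← ENNReal.rpow_mul, one_div_mul_cancel hq0.ne', ENNReal.rpow_one]
        _ ≤ _ := by
            rw [hMeq]
            exact ENNReal.rpow_le_rpow (ENNReal.ofReal_le_ofReal hs.le) hq0.le
    refine (lintegral_iprw_le hkd hn1 hp hs0 n μ (hbound d k n hk hn s hs0 μ hμs) P X hX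
      hlaw).trans (le_of_eq ?_)
    rw [ENNReal.ofReal_rpow_of_nonneg (by positivity) (by positivity),
      Real.mul_rpow (by positivity) (by positivity), Real.mul_rpow (by positivity) (by positivity),
      ← Real.rpow_mul hs0.le, mul_one_div_cancel hp0.ne', Real.rpow_one,
      rate_rpow_one_div hp k n hn1]
  rw [hMeq, ← ENNReal.ofReal_mul (by positivity), ← ENNReal.ofReal_mul (by positivity)]
  have hlim : Filter.Tendsto (fun s : ℝ => ENNReal.ofReal (C ^ (1 / p) * s * iprwRate p q k n))
      (nhdsWithin M (Set.Ioi M))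
      (nhds (ENNReal.ofReal (C ^ (1 / p) * M * iprwRate p q k n))) := by
    refine ENNReal.tendsto_ofReal (Filter.Tendsto.mono_left ?_ nhdsWithin_le_nhds)
    exact (Continuous.tendsto (by fun_prop) M)
  refine ge_of_tendsto hlim ?_
  filter_upwards [self_mem_nhdsWithin] with s hs
  exact hmain s hs
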